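/- **Spaces.** A generalized Stone space $(X,\mathcal K)$ is a topological space $X$ with a basis $\mathcal K$ of compact sets, closed under $A\cap B^c$ and $A\cup B$, such that for $x\ne y$ some $U\in\mathcal K$ has $x\in U$, $y\notin U$, and such that for every closed $Y$ and every non-empty downward-directed $\mathcal I\subseteq\mathcal K$ with $Y\cap U\neq\emptyset$ for all $U\in\mathcal I$, also $Y\cap\bigcap\mathcal I\ne\emptyset$. Let $\mathcal D_{\mathcal K}(X)=\{U\subseteq X: U^c\in\mathcal K\}$. A generalized modal space $(X,\mathcal K,R)$ has moreover a binary relation $R$ on $X$ such that each $R(x)$ is closed and $\Box U=\{x: R(x)\subseteq U\}\in\mathcal D_{\mathcal K}(X)$ for all $U\in\mathcal D_{\mathcal K}(X)$. **Language.** Formulas are built from propositional variables by $\top,\to,\wedge,\vee,\Box$ with the classical Kripke semantics on $(X,R)$. The inequality $\varphi\le\psi$ is admissibly valid on $(X,\mathcal K,R)$ if $V(\varphi)\subseteq V(\psi)$ for every valuation $V$ with all values in $\mathcal D_{\mathcal K}(X)$. The expanded language adds nominals $\mathbf i$, conominals $\mathbf m$, $\bot$ and $\blacklozenge$ (the diamond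 of $R^{-1}$). A formula is pure if it contains no propositional variable. The standard translation is $ST_x(p)=Px$, $ST_x(\mathbf i)=(x=i)$, $ST_x(\mathbf m)=(x\ne m)$, $ST_x(\Box\varphi)=\forall y(Rxy\to ST_y(\varphi))$, $ST_x(\blacklozenge\varphi)=\exists y(Ryx\wedge ST_y(\varphi))$, commuting with the other connectives; $ST(\varphi\le\psi)=\forall x(ST_x(\varphi)\to ST_x(\psi))$, and a quasi-inequality $\varphi_1\le\psi_1\,\&\dots\&\,\varphi_n\le\psi_n\Rightarrow\varphi\le\psi$ is translated as $\bigwedge_k ST(\varphi_k\le\psi_k)\to ST(\varphi\le\psi)$. **Inductive inequalities.** Let $<_\Omega$ be an irreflexive transitive relation on the variables and $A_p=\{q: q<_\Omega p\}$. Define $\mathsf{POS}_A::=p\,(p\in A)\mid\top\mid\Box\mathsf{POS}_A\mid\mathsf{POS}_A\wedge\mathsf{POS}_A\mid\mathsf{POS}_A\vee\mathsf{POS}_A$; $\ \mathsf{PIA}_p::=p\mid\top\mid\Box\mathsf{PIA}_p\mid\mathsf{POS}_{A_p}\to\mathsf{PIA}_p$; $\ \mathsf{Ant}::=\mathsf{PIA}_p\mid\mathsf{Ant}\wedge\mathsf{Ant}\mid\mathsf{Ant}\vee\mathsf{Ant}$;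 $\ \mathsf{Suc}::=p\mid\top\mid\mathsf{PIA}_q\to\mathsf{Suc}\mid\Box\mathsf{Suc}\mid\mathsf{Suc}\wedge\mathsf{Suc}\mid\mathsf{Suc}\vee\mathsf{Suc}$. The inequality $\varphi\le\psi$ is $\Omega$-inductive if $\varphi$ is an $\mathsf{Ant}$, $\psi$ is a $\mathsf{Suc}$, and every variable in it occurs both positively and negatively in $\varphi\to\psi$. **ALBA.** A run on an $\Omega$-inductive inequality $\varphi\le\psi$ is as follows. 1. Rewrite subformulas of $\varphi$ exhaustively by distributing $\wedge$ over $\vee$ (on either side), and subformulas of $\psi$ exhaustively by $\alpha\to\beta\wedge\gamma\rightsquigarrow(\alpha\to\beta)\wedge(\alpha\to\gamma)$, $\Box(\alpha\wedge\beta)\rightsquigarrow\Box\alpha\wedge\Box\beta$, and distributing $\vee$ over $\wedge$ (on either side). Split exhaustively: $\alpha\le\beta\wedge\gamma$ into $\alpha\le\beta$, $\alpha\le\gamma$; $\alpha\vee\beta\le\gamma$ into $\alpha\le\gamma$, $\beta\le\gamma$. From each resulting $\varphi_i\le\psi_i$ form the system $\{\mathbf i_0\le\varphi_i,\ \psi_i\le\mathbf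 m_0\}$. 2. In each system apply exhaustively, in any order: the two splitting rules; residuation ($\alpha\le\Box\beta$ becomes $\blacklozenge\alpha\le\beta$; $\alpha\le\beta\to\gamma$ becomes $\alpha\wedge\beta\le\gamma$); approximation ($\Box\alpha\le\mathbf m$ becomes $\alpha\le\mathbf n$, $\Box\mathbf n\le\mathbf m$ unless $\alpha$ is a conominal; $\alpha\to\beta\le\mathbf m$ becomes $\mathbf j\le\alpha$, $\beta\le\mathbf n$, $\mathbf j\to\mathbf n\le\mathbf m$ unless $\alpha$ is a nominal and $\beta$ a conominal; here $\mathbf j,\mathbf n$ are new, i.e. not in the system and different from $\mathbf i_0,\mathbf m_0$); deletion of $\alpha\le\top$. Then, as long as variables remain, choose an $\Omega$-minimal variable $p$ of the system and apply the right-handed Ackermann rule: replace $\{\theta_k\le p\}_{k=1}^n\cup\{\eta_l\le\iota_l\}_l$ by $\{\eta_l(\theta/p)\le\iota_l(\theta/p)\}_l$ with $\theta=\theta_1\vee\dots\vee\theta_n$ ($\bot$ if $n=0$), provided $p$ does not occur in any $\theta_k$, each $\eta_l$ is positive in $p$ and each $\iota_l$ is negative in $p$. The result is a pure system $S_i$.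 3. Output $\mathsf{FO}(\varphi\le\psi)$: the conjunction over $i$ of the universal closures (over all individual variables) of the standard translations of the pure quasi-inequalities $\&S_i\Rightarrow\mathbf i_0\le\mathbf m_0$. It is a first-order sentence in the language of one binary relation symbol $R$. **Theorem (Soundness).** Let $\varphi\le\psi$ be an $\Omega$-inductive inequality. For every run of ALBA on it as above, with output $\mathsf{FO}(\varphi\le\psi)$, and every generalized modal space $(X,\mathcal K,R)$: $\varphi\le\psi$ is admissibly valid on $(X,\mathcal K,R)$ if and only if $(X,R)\models\mathsf{FO}(\varphi\le\psi)$. Moreover such a run with an output exists; so every inductive inequality has a first-order correspondent on generalized modal spaces. -/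

import Mathlib

universe u w

namespace GenModal

/-! ## Generalized modal spaces -/

/-- `(X, 𝒦)` is a generalized Stone space; the topology on `X` is the one with basis `𝒦`.
Directed families are non-empty. -/
structure IsGenStoneSpace {X : Type*} [TopologicalSpace X] (K : Set (Set X)) : Prop where
  separates : ∀ x y : X, x ≠ y → ∃ U ∈ K, x ∈ U ∧ y ∉ U
  isBasis : TopologicalSpace.IsTopologicalBasis K
  isCompact : ∀ U ∈ K, IsCompact U
  inter_compl_mem : ∀ A ∈ K, ∀ B ∈ K, A ∩ Bᶜ ∈ K
  union_mem : ∀ A ∈ K, ∀ B ∈ K, A ∪ B ∈ K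
  directed : ∀ Y : Set X, IsClosed Y → ∀ I ⊆ K, I.Nonempty → DirectedOn (· ⊇ ·) I →
    (∀ U ∈ I, (Y ∩ U).Nonempty) → (Y ∩ ⋂₀ I).Nonempty

/-- The family `𝒟_𝒦(X)` of complements of members of `𝒦`. -/
def admissibleSets {X : Type*} (K : Set (Set X)) : Set (Set X) := {U | Uᶜ ∈ K}

/-- `(X, 𝒦, R)` is a generalized modal space. -/
structure IsGenModalSpace {X : Type*} [TopologicalSpace X] (K : Set (Set X))
    (R : X → X → Prop) : Prop extends IsGenStoneSpace K where
  isClosed_image : ∀ x, IsClosed {y | R x y}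
  box_mem : ∀ U ∈ admissibleSets K, {x | {y | R x y} ⊆ U} ∈ admissibleSets K

/-! ## The generalized modal language and its semantics -/

/-- Formulas of the generalized modal language over the propositional variables `P`. -/
inductive Fml (P : Type*) where
  | var (p : P)
  | top
  | imp (a b : Fml P)
  | and (a b : Fml P)
  | or (a b : Fml P)
  | box (a : Fml P)

/-- The truth set of a formula under a valuation `V`. -/
def Fml.truth {P X : Type*} (R : X → X → Prop) (V : P → Set X) : Fml P → Set X
  | .var p => V p
  | .top => Set.univ
  | .imp a b => {w | w ∈ a.truth R V → w ∈ b.truth R V}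
  | .and a b => a.truth R V ∩ b.truth R V
  | .or a b => a.truth R V ∪ b.truth R V
  | .box a => {w | ∀ v, R w v → v ∈ a.truth R V}

/-- `φ ≤ ψ` holds under every admissible valuation. -/
def AdmissiblyValid {P X : Type*} (K : Set (Set X)) (R : X → X → Prop) (φ ψ : Fml P) : Prop :=
  ∀ V : P → Set X, (∀ p, V p ∈ admissibleSets K) → φ.truth R V ⊆ ψ.truth R V

/-! ## The expanded language -/

/-- Formulas of the expanded language. Nominals and conominals are both indexed by `ℕ`;
`bdia` is the black diamond (the diamond of the converse relation). -/
inductive XFml (P : Type*) where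
  | var (p : P)
  | nom (i : ℕ)
  | conom (m : ℕ)
  | bot
  | top
  | and (a b : XFml P)
  | or (a b : XFml P)
  | imp (a b : XFml P)
  | box (a : XFml P)
  | bdia (a : XFml P)

/-- The inclusion of the basic language into the expanded one. -/
def Fml.toX {P : Type*} : Fml P → XFml P
  | .var p => .var p
  | .top => .top
  | .imp a b => .imp a.toX b.toX
  | .and a b => .and a.toX b.toX
  | .or a b => .or a.toX b.toX
  | .box a => .box a.toX

namespace XFml

variable {P : Type*}

/-- `a.Occurs p true` (`a.Occurs p false`): the variable `p` has a positive (negative) occurrence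
in `a`, that is, one in the scope of an even (odd) number of left-hand sides of implications. -/
def Occurs (p : P) : Bool → XFml P → Prop
  | s, .var q => s = true ∧ q = p
  | _, .nom _ => False
  | _, .conom _ => False
  | _, .bot => False
  | _, .top => False
  | s, .and a b => a.Occurs p s ∨ b.Occurs p s
  | s, .or a b => a.Occurs p s ∨ b.Occurs p s
  | s, .imp a b => a.Occurs p (!s) ∨ b.Occurs p s
  | s, .box a => a.Occurs p s
  | s, .bdia a => a.Occurs p s

/-- `p` occurs in `a`, with any sign. -/
def Mentions (p : P) (a : XFml P) : Prop := a.Occurs p true ∨ a.Occurs p false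

/-- Every occurrence of `p` in `a` is positive. -/
def PositiveIn (p : P) (a : XFml P) : Prop := ¬ a.Occurs p false

/-- Every occurrence of `p` in `a` is negative. -/
def NegativeIn (p : P) (a : XFml P) : Prop := ¬ a.Occurs p true

/-- The nominals occurring in a formula. -/
def noms : XFml P → Set ℕ
  | .nom i => {i}
  | .and a b | .or a b | .imp a b => a.noms ∪ b.noms
  | .box a | .bdia a => a.noms
  | .var _ | .conom _ | .bot | .top => ∅

/-- The conominals occurring in a formula. -/
def conoms : XFml P → Set ℕ
  | .conom m => {m}
  | .and a b | .or a b | .imp a b => a.conoms ∪ b.conoms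
  | .box a | .bdia a => a.conoms
  | .var _ | .nom _ | .bot | .top => ∅

/-- Uniform substitution of formulas for propositional variables. -/
def bind {Q : Type*} (f : P → XFml Q) : XFml P → XFml Q
  | .var p => f p
  | .nom i => .nom i
  | .conom m => .conom m
  | .bot => .bot
  | .top => .top
  | .and a b => .and (a.bind f) (b.bind f)
  | .or a b => .or (a.bind f) (b.bind f)
  | .imp a b => .imp (a.bind f) (b.bind f)
  | .box a => .box (a.bind f)
  | .bdia a => .bdia (a.bind f)

open Classical in
/-- `a(θ/p)`: substitution of `θ` for the single variable `p`. -/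
noncomputable def subst (p : P) (θ : XFml P) (a : XFml P) : XFml P :=
  a.bind fun q => if q = p then θ else .var q

/-- A pure formula (one over the empty set of variables), read over `P`. -/
def ofPure (a : XFml Empty) : XFml P := a.bind fun e => e.elim

/-- The disjunction `θ₁ ∨ … ∨ θₙ`; it is `⊥` for `n = 0`. -/
def bigOr : List (XFml P) → XFml P
  | [] => .bot
  | [a] => a
  | a :: b :: l => .or a (bigOr (b :: l))

end XFml

/-- An inequality `lhs ≤ rhs` of the expanded language. -/
structure XIneq (P : Type*) where
  lhs : XFml P
  rhs : XFml P

namespace XIneq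

variable {P : Type*}

/-- Substitution of `θ` for `p` on both sides. -/
noncomputable def subst (p : P) (θ : XFml P) (e : XIneq P) : XIneq P :=
  ⟨XFml.subst p θ e.lhs, XFml.subst p θ e.rhs⟩

/-- A pure inequality, read over `P`. -/
def ofPure (e : XIneq Empty) : XIneq P := ⟨XFml.ofPure e.lhs, XFml.ofPure e.rhs⟩

end XIneq

/-! ## Inductive inequalities -/

/-- `POS_A`. -/
inductive IsPos {P : Type*} (A : Set P) : Fml P → Prop
  | var {p} : p ∈ A → IsPos A (.var p)
  | top : IsPos A .top
  | box {a} : IsPos A a → IsPos A (.box a)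
  | and {a b} : IsPos A a → IsPos A b → IsPos A (.and a b)
  | or {a b} : IsPos A a → IsPos A b → IsPos A (.or a b)

/-- `PIA_p`, for the dependence order `Ω` (`Ω q p` means `q <_Ω p`). -/
inductive IsPIA {P : Type*} (Ω : P → P → Prop) (p : P) : Fml P → Prop
  | var : IsPIA Ω p (.var p)
  | top : IsPIA Ω p .top
  | box {a} : IsPIA Ω p a → IsPIA Ω p (.box a)
  | imp {a b} : IsPos {q | Ω q p} a → IsPIA Ω p b → IsPIA Ω p (.imp a b)

/-- Inductive antecedents. -/
inductive IsAnt {P : Type*} (Ω : P → P → Prop) : Fml P → Prop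
  | pia {p a} : IsPIA Ω p a → IsAnt Ω a
  | and {a b} : IsAnt Ω a → IsAnt Ω b → IsAnt Ω (.and a b)
  | or {a b} : IsAnt Ω a → IsAnt Ω b → IsAnt Ω (.or a b)

/-- Inductive succedents. -/
inductive IsSuc {P : Type*} (Ω : P → P → Prop) : Fml P → Prop
  | var {p} : IsSuc Ω (.var p)
  | top : IsSuc Ω .top
  | imp {q a b} : IsPIA Ω q a → IsSuc Ω b → IsSuc Ω (.imp a b)
  | box {a} : IsSuc Ω a → IsSuc Ω (.box a)
  | and {a b} : IsSuc Ω a → IsSuc Ω b → IsSuc Ω (.and a b)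
  | or {a b} : IsSuc Ω a → IsSuc Ω b → IsSuc Ω (.or a b)

/-- `φ ≤ ψ` is an `Ω`-inductive inequality. Signs of occurrences in `φ ≤ ψ` are those in
`φ → ψ`. -/
structure IsInductive {P : Type*} (Ω : P → P → Prop) (φ ψ : Fml P) : Prop where
  irrefl : ∀ p, ¬ Ω p p
  trans : ∀ p q r, Ω p q → Ω q r → Ω p r
  ant : IsAnt Ω φ
  suc : IsSuc Ω ψ
  signs : ∀ p, (Fml.imp φ ψ).toX.Mentions p →
    (Fml.imp φ ψ).toX.Occurs p true ∧ (Fml.imp φ ψ).toX.Occurs p false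

/-! ## The first-order correspondence language and the standard translation -/

/-- Relation symbols: a unary one for each propositional variable and a binary one. -/
inductive CorrRel (P : Type*) : ℕ → Type _
  | pred (p : P) : CorrRel P 1
  | acc : CorrRel P 2

/-- The first-order correspondence language. For `P = Empty` its only non-logical symbol is the
binary relation symbol. -/
def corrLang (P : Type*) : FirstOrder.Language := ⟨fun _ => Empty, CorrRel P⟩

/-- The first-order structure given by a relation `R` and a valuation `V`. -/
@[reducible] def corrStructure {P X : Type*} (R : X → X → Prop) (V : P → Set X) :
    (corrLang P).Structure X where
  funMap := fun f => nomatch f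
  RelMap := fun r v => match r, v with
    | .pred p, v => v 0 ∈ V p
    | .acc, v => R (v 0) (v 1)

/-- `X ⊨ χ` for a sentence `χ` in the language of a single binary relation. -/
def FOTrue {X : Type*} (R : X → X → Prop) (χ : (corrLang Empty).Sentence) : Prop :=
  @FirstOrder.Language.Sentence.Realize (corrLang Empty) X
    (corrStructure R fun e => e.elim) χ

section StandardTranslation

open FirstOrder FirstOrder.Language

variable {P : Type*}

/-- The individual variables: one for each nominal (`Sum.inl`), one for each conominal
(`Sum.inr`). -/
abbrev IndVar : Type := ℕ ⊕ ℕ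

/-- The atom `R x y`, with `x` and `y` given as bound variables. -/
def accAtom {n : ℕ} (x y : Fin n) : (corrLang P).BoundedFormula IndVar n :=
  Relations.boundedFormula₂ (L := corrLang P) CorrRel.acc
    (Term.var (Sum.inr x)) (Term.var (Sum.inr y))

/-- The standard translation `ST_x`, where `x` is the bound variable number `x`. -/
def stdTr : XFml P → {n : ℕ} → Fin n → (corrLang P).BoundedFormula IndVar n
  | .var p, _, x =>
      Relations.boundedFormula₁ (L := corrLang P) (CorrRel.pred p) (Term.var (Sum.inr x))
  | .nom i, _, x =>
      Term.bdEqual (Term.var (Sum.inr x)) (Term.var (Sum.inl (Sum.inl i)))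
  | .conom m, _, x =>
      (Term.bdEqual (Term.var (Sum.inr x)) (Term.var (Sum.inl (Sum.inr m)))).not
  | .bot, _, _ => ⊥
  | .top, _, _ => ⊤
  | .and a b, _, x => stdTr a x ⊓ stdTr b x
  | .or a b, _, x => stdTr a x ⊔ stdTr b x
  | .imp a b, _, x => (stdTr a x).imp (stdTr b x)
  | .box a, n, x => ((accAtom x.castSucc (Fin.last n)).imp (stdTr a (Fin.last n))).all
  | .bdia a, n, x => (accAtom (Fin.last n) x.castSucc ⊓ stdTr a (Fin.last n)).ex

/-- `ST(φ ≤ ψ) = ∀ x (ST_x(φ) → ST_x(ψ))`. -/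
def STIneq (e : XIneq P) : (corrLang P).Formula IndVar :=
  ((stdTr e.lhs (0 : Fin 1)).imp (stdTr e.rhs (0 : Fin 1))).all

/-- The standard translation of the quasi-inequality `e₁ & … & eₙ ⇒ e`. -/
def STQuasi (S : List (XIneq P)) (e : XIneq P) : (corrLang P).Formula IndVar :=
  BoundedFormula.imp ((S.map STIneq).foldr (· ⊓ ·) ⊤) (STIneq e)

/-- The universal closure of a formula with respect to all its individual variables. -/
noncomputable def univClosure (φ : (corrLang P).Formula IndVar) : (corrLang P).Sentence :=
  Formula.iAlls (α := Empty) {v // v ∈ φ.freeVarFinset}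
    (BoundedFormula.restrictFreeVar φ fun v => Sum.inr v)

end StandardTranslation

/-! ## The algorithm ALBA -/

namespace ALBA

variable {P : Type*}

/-- `b` is reached from `a` by applying `step` exhaustively. -/
def Exhausts {α : Type*} (step : α → α → Prop) (a b : α) : Prop :=
  Relation.ReflTransGen step a b ∧ ∀ c, ¬ step b c

/-- Distribution rules for antecedents. -/
inductive AntRule : Fml P → Fml P → Prop
  | and_or (a b c) : AntRule (.and a (.or b c)) (.or (.and a b) (.and a c))
  | or_and (a b c) : AntRule (.and (.or b c) a) (.or (.and b a) (.and c a))

/-- Distribution rules for succedents. -/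
inductive SucRule : Fml P → Fml P → Prop
  | imp_and (a b c) : SucRule (.imp a (.and b c)) (.and (.imp a b) (.imp a c))
  | box_and (a b) : SucRule (.box (.and a b)) (.and (.box a) (.box b))
  | or_and (a b c) : SucRule (.or a (.and b c)) (.and (.or a b) (.or a c))
  | and_or (a b c) : SucRule (.or (.and b c) a) (.and (.or b a) (.or c a))

/-- Rewriting of one subformula by a rule. -/
inductive Rewrite (rule : Fml P → Fml P → Prop) : Fml P → Fml P → Prop
  | root {a b} : rule a b → Rewrite rule a b
  | imp_left {a a'} (b) : Rewrite rule a a' → Rewrite rule (.imp a b) (.imp a' b)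
  | imp_right (a) {b b'} : Rewrite rule b b' → Rewrite rule (.imp a b) (.imp a b')
  | and_left {a a'} (b) : Rewrite rule a a' → Rewrite rule (.and a b) (.and a' b)
  | and_right (a) {b b'} : Rewrite rule b b' → Rewrite rule (.and a b) (.and a b')
  | or_left {a a'} (b) : Rewrite rule a a' → Rewrite rule (.or a b) (.or a' b)
  | or_right (a) {b b'} : Rewrite rule b b' → Rewrite rule (.or a b) (.or a b')
  | box {a a'} : Rewrite rule a a' → Rewrite rule (.box a) (.box a')

/-- The splitting rules of the first stage, on a list of inequalities `φ ≤ ψ` (pairs `(φ, ψ)`). -/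
inductive SplitStep : List (Fml P × Fml P) → List (Fml P × Fml P) → Prop
  | and (S T) (a b c : Fml P) :
      SplitStep (S ++ (a, .and b c) :: T) (S ++ (a, b) :: (a, c) :: T)
  | or (S T) (a b c : Fml P) :
      SplitStep (S ++ (.or a b, c) :: T) (S ++ (a, c) :: (b, c) :: T)

/-- First approximation of `φ ≤ ψ`: the system `{i₀ ≤ φ, ψ ≤ m₀}`. The nominal `i₀` and the
conominal `m₀` are those with index `0`. -/
def firstApprox (e : Fml P × Fml P) : List (XIneq P) :=
  [⟨.nom 0, e.1.toX⟩, ⟨e.2.toX, .conom 0⟩]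

/-- The nominal `j` is new for the quasi-inequality `&S ⇒ i₀ ≤ m₀`. -/
def FreshNom (S : List (XIneq P)) (j : ℕ) : Prop :=
  j ≠ 0 ∧ ∀ e ∈ S, j ∉ e.lhs.noms ∧ j ∉ e.rhs.noms

/-- The conominal `n` is new for the quasi-inequality `&S ⇒ i₀ ≤ m₀`. -/
def FreshConom (S : List (XIneq P)) (n : ℕ) : Prop :=
  n ≠ 0 ∧ ∀ e ∈ S, n ∉ e.lhs.conoms ∧ n ∉ e.rhs.conoms

/-- The splitting, residuation, approximation and deleting rules of the second stage:
`LocalRule S e l` says that the inequality `e` of the system `S` may be replaced by the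
inequalities in `l`. An approximation rule is not applied to an inequality which already is an
output `□n ≤ m` or `j → n ≤ m` of that rule. -/
inductive LocalRule (S : List (XIneq P)) : XIneq P → List (XIneq P) → Prop
  | split_and (a b c) : LocalRule S ⟨a, .and b c⟩ [⟨a, b⟩, ⟨a, c⟩]
  | split_or (a b c) : LocalRule S ⟨.or a b, c⟩ [⟨a, c⟩, ⟨b, c⟩]
  | resid_box (a b) : LocalRule S ⟨a, .box b⟩ [⟨.bdia a, b⟩]
  | resid_imp (a b c) : LocalRule S ⟨a, .imp b c⟩ [⟨.and a b, c⟩]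
  | approx_box (a m n) : (∀ k, a ≠ .conom k) → FreshConom S n →
      LocalRule S ⟨.box a, .conom m⟩ [⟨a, .conom n⟩, ⟨.box (.conom n), .conom m⟩]
  | approx_imp (a b m j n) : (¬ ∃ i k, a = .nom i ∧ b = .conom k) →
      FreshNom S j → FreshConom S n →
      LocalRule S ⟨.imp a b, .conom m⟩
        [⟨.nom j, a⟩, ⟨b, .conom n⟩, ⟨.imp (.nom j) (.conom n), .conom m⟩]
  | delete (a) : LocalRule S ⟨a, .top⟩ []

/-- One application of a splitting, residuation, approximation or deleting rule to a system. -/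
inductive ReduceStep : List (XIneq P) → List (XIneq P) → Prop
  | mk (S T e l) : LocalRule (S ++ e :: T) e l → ReduceStep (S ++ e :: T) (S ++ l ++ T)

/-- The variable `p` occurs in the system `S`. -/
def VarOf (S : List (XIneq P)) (p : P) : Prop :=
  ∃ e ∈ S, e.lhs.Mentions p ∨ e.rhs.Mentions p

/-- The right-handed Ackermann rule, applied to an `Ω`-minimal variable of the system. -/
inductive AckermannStep (Ω : P → P → Prop) : List (XIneq P) → List (XIneq P) → Prop
  | mk (S : List (XIneq P)) (p : P) (θs : List (XFml P)) (E : List (XIneq P)) :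
      VarOf S p → (∀ q, VarOf S q → ¬ Ω q p) →
      S.Perm (θs.map (fun θ => ⟨θ, .var p⟩) ++ E) →
      (∀ θ ∈ θs, ¬ θ.Mentions p) →
      (∀ e ∈ E, e.lhs.PositiveIn p ∧ e.rhs.NegativeIn p) →
      AckermannStep Ω S (E.map (XIneq.subst p (XFml.bigOr θs)))

/-- The second stage reduces the system `S` to the pure system `T`: first the splitting,
residuation, approximation and deleting rules are applied exhaustively, then the right-handed
Ackermann rule eliminates the variables, an `Ω`-minimal one at a time. -/
def Reduces (Ω : P → P → Prop) (S : List (XIneq P)) (T : List (XIneq Empty)) : Prop :=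
  ∃ S', Exhausts ReduceStep S S' ∧
    Relation.ReflTransGen (AckermannStep Ω) S' (T.map XIneq.ofPure)

/-- The first-order sentence of the output quasi-inequalities `&T ⇒ i₀ ≤ m₀`, for `T` in `Q`. -/
noncomputable def outputSentence (Q : List (List (XIneq Empty))) : (corrLang Empty).Sentence :=
  (Q.map fun T => univClosure (STQuasi T ⟨.nom 0, .conom 0⟩)).foldr (· ⊓ ·) ⊤

/-- Some run of ALBA on `φ ≤ ψ`, which uses the dependence order `Ω`, outputs the sentence `χ`. -/
def Outputs (Ω : P → P → Prop) (φ ψ : Fml P) (χ : (corrLang Empty).Sentence) : Prop :=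
  ∃ (φ' ψ' : Fml P) (L : List (Fml P × Fml P)) (Q : List (List (XIneq Empty))),
    Exhausts (Rewrite AntRule) φ φ' ∧ Exhausts (Rewrite SucRule) ψ ψ' ∧
    Exhausts SplitStep [(φ', ψ')] L ∧
    List.Forall₂ (fun e T => Reduces Ω (firstApprox e) T) L Q ∧
    χ = outputSentence Q

end ALBA

end GenModal

/-!
The individual steps of a run preserve the admissible validity of the quasi-inequality
`&S ⇒ i₀ ≤ m₀` of the current system `S` (`QuasiValid`), and the first approximation of `φ ≤ ψ`
is quasi-valid if and only if `φ ≤ ψ` is admissibly valid. At the end of a run the system is pure,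
so that valuations no longer matter and quasi-validity is the truth of the first-order output.

Splitting, residuation and approximation are sound on every relational structure, for arbitrary
valuations. Only the Ackermann rule needs topology: the minimal valuation `θ₁ ∨ … ∨ θₙ` of a
variable is in general not admissible, and has to be replaced by an admissible set. The inductive
shape of `φ ≤ ψ` guarantees that, when the rule is applied, the `θₖ` and all other left-hand sides
are syntactically closed, that is, built from nominals and variables without implications and
conominals (`XFml.IsSynClosed`), and all right-hand sides have compact complements, being variables
or conominals (`IsAckermannShape`); the exceptions `□n ≤ m` and `j → n ≤ m` are pure. Syntactically
closed formulas take closed values and preserve the intersection of the directed family of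
admissible sets including a given closed set `C`
(`XFml.IsSynClosed.exists_admissible_notMem_truth`). So if a left-hand side takes at `C` a value
inside a set with compact complement, it does so already at some admissible set including `C`, and
finitely many such sets can be intersected. The space need not be compact. What replaces its
compactness in the clause for the black diamond is that the set of predecessors of a point is
compact (`IsGenModalSpace.isCompact_predecessors`): it is disjoint from `□U`, a set with compact
complement, for any admissible `U` which omits the point. This also covers the case `n = 0`, where
`C` is empty.

A run exists because the rules of the first stage decrease polynomial interpretations of formulas,
those of the second decrease a weight of systems, and a system to which no local rule applies has
the shape required by the Ackermann rule; its bounds `θ ≤ p` mention only variables below `p`, so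
that the rule applies to every `Ω`-minimal variable and removes it.
-/

namespace GenModal

open Set

/-! ### Topology of generalized modal spaces -/

namespace IsGenStoneSpace

variable {X : Type*} [TopologicalSpace X] {K : Set (Set X)}

lemma isClosed_of_mem (h : IsGenStoneSpace K) {U : Set X} (hU : U ∈ K) : IsClosed U := by
  rw [← isOpen_compl_iff, h.isBasis.isOpen_iff]
  intro x hx
  obtain ⟨V, hV, hxV, -⟩ := h.isBasis.exists_subset_of_mem_open (mem_univ x) isOpen_univ
  exact ⟨V ∩ Uᶜ, h.inter_compl_mem V hV U hU, ⟨hxV, hx⟩, inter_subset_right⟩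

lemma isClosed_of_mem_admissibleSets (h : IsGenStoneSpace K) {U : Set X}
    (hU : U ∈ admissibleSets K) : IsClosed U :=
  isOpen_compl_iff.1 (h.isBasis.isOpen hU)

lemma isOpen_of_mem_admissibleSets (h : IsGenStoneSpace K) {U : Set X}
    (hU : U ∈ admissibleSets K) : IsOpen U :=
  isClosed_compl_iff.1 (h.isClosed_of_mem hU)

lemma inter_mem_admissibleSets (h : IsGenStoneSpace K) {U V : Set X}
    (hU : U ∈ admissibleSets K) (hV : V ∈ admissibleSets K) : U ∩ V ∈ admissibleSets K := by
  simpa only [admissibleSets, mem_ofPred_eq, compl_inter] using h.union_mem _ hU _ hV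

lemma univ_mem_admissibleSets (h : IsGenStoneSpace K) [Nonempty X] :
    univ ∈ admissibleSets K := by
  obtain ⟨x⟩ := ‹Nonempty X›
  obtain ⟨V, hV, -, -⟩ := h.isBasis.exists_subset_of_mem_open (mem_univ x) isOpen_univ
  simpa only [admissibleSets, mem_ofPred_eq, compl_univ, inter_compl_self]
    using h.inter_compl_mem V hV V hV

/-- Every closed set is the intersection of the admissible sets that include it. -/
lemma exists_admissible_superset (h : IsGenStoneSpace K) {C : Set X} (hC : IsClosed C) {x : X}
    (hx : x ∉ C) : ∃ U ∈ admissibleSets K, C ⊆ U ∧ x ∉ U := by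
  obtain ⟨V, hV, hxV, hVC⟩ := h.isBasis.exists_subset_of_mem_open
    (show x ∈ Cᶜ from hx) hC.isOpen_compl
  exact ⟨Vᶜ, by simpa [admissibleSets] using hV, subset_compl_comm.1 hVC, by simpa using hxV⟩

end IsGenStoneSpace

namespace IsGenModalSpace

variable {X : Type*} [TopologicalSpace X] {K : Set (Set X)} {R : X → X → Prop}

lemma isClosed_box (h : IsGenModalSpace K R) {C : Set X} (hC : IsClosed C) :
    IsClosed {x | ∀ y, R x y → y ∈ C} := by
  rw [← isOpen_compl_iff, isOpen_iff_forall_mem_open]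
  intro x hx
  simp only [mem_compl_iff, mem_ofPred_eq, not_forall] at hx
  obtain ⟨y, hxy, hy⟩ := hx
  obtain ⟨U, hU, hCU, hyU⟩ := h.exists_admissible_superset hC hy
  refine ⟨{x | {y | R x y} ⊆ U}ᶜ, fun z hz hz' => hz fun t ht => hCU (hz' t ht),
    (h.isClosed_of_mem_admissibleSets (h.box_mem U hU)).isOpen_compl, fun hx' => hyU (hx' hxy)⟩

/-- If `x` is outside an admissible set `U`, then the predecessors of `x` lie in the compact
complement of `□U`; they form a closed set because every `R(y)` is closed. -/
lemma isCompact_predecessors (h : IsGenModalSpace K R) (x : X) : IsCompact {y | R y x} := by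
  obtain ⟨V, hV, hxV, -⟩ := h.isBasis.exists_subset_of_mem_open (mem_univ x) isOpen_univ
  have hV' : Vᶜ ∈ admissibleSets K := by simpa [admissibleSets] using hV
  refine (h.isCompact _ (h.box_mem _ hV')).of_isClosed_subset ?_ fun y hy hy' => hy' hy hxV
  rw [← isOpen_compl_iff, isOpen_iff_forall_mem_open]
  intro y hy
  obtain ⟨U, hU, hRU, hxU⟩ := h.exists_admissible_superset (h.isClosed_image y) hy
  exact ⟨{x | {y | R x y} ⊆ U}, fun z hz hzx => hxU (hz hzx),
    h.isOpen_of_mem_admissibleSets (h.box_mem U hU), hRU⟩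

/-- The `R`-image of a closed set is closed, although the space need not be compact: only the
part of the set below a compact open neighbourhood of a given point matters, and that part is
compact. -/
lemma isClosed_bdia (h : IsGenModalSpace K R) {C : Set X} (hC : IsClosed C) :
    IsClosed {y | ∃ x, R x y ∧ x ∈ C} := by
  rw [← isOpen_compl_iff, isOpen_iff_forall_mem_open]
  intro x hx
  obtain ⟨V, hV, hxV, -⟩ := h.isBasis.exists_subset_of_mem_open (mem_univ x) isOpen_univ
  have hV' : Vᶜ ∈ admissibleSets K := by simpa [admissibleSets] using hV
  have hcomp : IsCompact ({x | {y | R x y} ⊆ Vᶜ}ᶜ ∩ C) :=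
    (h.isCompact _ (h.box_mem _ hV')).inter_right hC
  obtain ⟨N, hN, hxN, hdis⟩ : ∃ N, IsOpen N ∧ x ∈ N ∧
      ∀ z ∈ {x | {y | R x y} ⊆ Vᶜ}ᶜ ∩ C, ∀ y ∈ N, ¬ R z y := by
    refine hcomp.induction_on (p := fun s => ∃ N, IsOpen N ∧ x ∈ N ∧ ∀ z ∈ s, ∀ y ∈ N, ¬ R z y)
      ⟨univ, isOpen_univ, mem_univ x, fun z hz => hz.elim⟩ ?_ ?_ ?_
    · rintro s t hst ⟨N, hN, hxN, hN'⟩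
      exact ⟨N, hN, hxN, fun z hz => hN' z (hst hz)⟩
    · rintro s t ⟨N, hN, hxN, hN'⟩ ⟨M, hM, hxM, hM'⟩
      refine ⟨N ∩ M, hN.inter hM, ⟨hxN, hxM⟩, ?_⟩
      rintro z (hz | hz) y ⟨hyN, hyM⟩
      exacts [hN' z hz y hyN, hM' z hz y hyM]
    · rintro z ⟨-, hz⟩
      obtain ⟨U, hU, hRU, hxU⟩ := h.exists_admissible_superset (h.isClosed_image z)
        (x := x) fun hzx => hx ⟨z, hzx, hz⟩
      exact ⟨{x | {y | R x y} ⊆ U}, mem_nhdsWithin_of_mem_nhds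
        ((h.isOpen_of_mem_admissibleSets (h.box_mem U hU)).mem_nhds hRU),
        Uᶜ, (h.isClosed_of_mem_admissibleSets hU).isOpen_compl, hxU,
        fun t ht y hy hty => hy (ht hty)⟩
  refine ⟨N ∩ V, ?_, hN.inter (h.isBasis.isOpen hV), hxN, hxV⟩
  rintro y ⟨hyN, hyV⟩ ⟨z, hzy, hz⟩
  exact hdis z ⟨fun hz' => hz' hzy hyV, hz⟩ y hyN hzy

end IsGenModalSpace

/-! ### Semantics of the expanded language -/

section Semantics

variable {P X : Type*}

/-- The truth set of a formula of the expanded language. The assignment `g` interprets the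
individual variables of the standard translation: `nom i` denotes `{g (inl i)}` and `conom m`
denotes the complement of `{g (inr m)}`. -/
def XFml.truth (R : X → X → Prop) (V : P → Set X) (g : IndVar → X) : XFml P → Set X
  | .var p => V p
  | .nom i => {g (Sum.inl i)}
  | .conom m => {g (Sum.inr m)}ᶜ
  | .bot => ∅
  | .top => univ
  | .and a b => a.truth R V g ∩ b.truth R V g
  | .or a b => a.truth R V g ∪ b.truth R V g
  | .imp a b => {w | w ∈ a.truth R V g → w ∈ b.truth R V g}
  | .box a => {w | ∀ v, R w v → v ∈ a.truth R V g}
  | .bdia a => {w | ∃ v, R v w ∧ v ∈ a.truth R V g}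

/-- The inequality `lhs ≤ rhs` holds under a valuation and an assignment. -/
def XIneq.Holds (R : X → X → Prop) (V : P → Set X) (g : IndVar → X) (e : XIneq P) : Prop :=
  e.lhs.truth R V g ⊆ e.rhs.truth R V g

/-- Admissible validity of the quasi-inequality `&S ⇒ i₀ ≤ m₀`. -/
def QuasiValid (K : Set (Set X)) (R : X → X → Prop) (S : List (XIneq P)) : Prop :=
  ∀ V : P → Set X, (∀ p, V p ∈ admissibleSets K) → ∀ g : IndVar → X,
    (∀ e ∈ S, e.Holds R V g) → g (Sum.inl 0) ≠ g (Sum.inr 0)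

variable {R : X → X → Prop}

lemma Fml.truth_toX (V : P → Set X) (g : IndVar → X) (a : Fml P) :
    a.toX.truth R V g = a.truth R V := by
  induction a <;> simp_all [Fml.toX, XFml.truth, Fml.truth]

lemma XFml.truth_bind {Q : Type*} (V : Q → Set X) (g : IndVar → X) (f : P → XFml Q)
    (a : XFml P) :
    (a.bind f).truth R V g = a.truth R (fun p => (f p).truth R V g) g := by
  induction a <;> simp_all [XFml.bind, XFml.truth]

lemma XFml.truth_subst [DecidableEq P] (V : P → Set X) (g : IndVar → X) (p : P) (θ a : XFml P) :
    (XFml.subst p θ a).truth R V g = a.truth R (Function.update V p (θ.truth R V g)) g := by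
  rw [XFml.subst, XFml.truth_bind]
  congr 1
  funext q
  by_cases hq : q = p
  · subst hq; simp
  · simp [hq, XFml.truth]

lemma XFml.truth_ofPure (V : P → Set X) (V' : Empty → Set X) (g : IndVar → X) (a : XFml Empty) :
    (XFml.ofPure a : XFml P).truth R V g = a.truth R V' g := by
  rw [XFml.ofPure, XFml.truth_bind]
  congr 1
  funext e
  exact e.elim

lemma XFml.truth_bigOr (V : P → Set X) (g : IndVar → X) (l : List (XFml P)) :
    (XFml.bigOr l).truth R V g = {x | ∃ a ∈ l, x ∈ a.truth R V g} := by
  induction l using XFml.bigOr.induct with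
  | case1 => simp [XFml.bigOr, XFml.truth]
  | case2 a => simp [XFml.bigOr]
  | case3 a b l ih =>
    simp only [XFml.bigOr, XFml.truth, ih]
    ext x
    simp

/-- The truth set depends only on the values at the variables, nominals and conominals that
occur. -/
lemma XFml.truth_congr {V V' : P → Set X} {g g' : IndVar → X} {a : XFml P}
    (hV : ∀ p, a.Mentions p → V p = V' p) (hn : ∀ i ∈ a.noms, g (Sum.inl i) = g' (Sum.inl i))
    (hm : ∀ m ∈ a.conoms, g (Sum.inr m) = g' (Sum.inr m)) :
    a.truth R V g = a.truth R V' g' := by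
  induction a with
  | var p => exact hV p (Or.inl ⟨rfl, rfl⟩)
  | nom i => simp [XFml.truth, hn i rfl]
  | conom m => simp [XFml.truth, hm m rfl]
  | bot => rfl
  | top => rfl
  | and a b iha ihb | or a b iha ihb =>
    simp only [XFml.truth]
    rw [iha (fun p hp => hV p (hp.imp Or.inl Or.inl)) (fun i hi => hn i (Or.inl hi))
        (fun i hi => hm i (Or.inl hi)),
      ihb (fun p hp => hV p (hp.imp Or.inr Or.inr)) (fun i hi => hn i (Or.inr hi))
        (fun i hi => hm i (Or.inr hi))]
  | imp a b iha ihb =>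
    simp only [XFml.truth]
    rw [iha (fun p hp => hV p (hp.symm.imp Or.inl Or.inl)) (fun i hi => hn i (Or.inl hi))
        (fun i hi => hm i (Or.inl hi)),
      ihb (fun p hp => hV p (hp.imp Or.inr Or.inr)) (fun i hi => hn i (Or.inr hi))
        (fun i hi => hm i (Or.inr hi))]
  | box a ih | bdia a ih =>
    simp only [XFml.truth]
    rw [ih hV hn hm]

end Semantics

/-! ### Syntactically closed formulas and the Ackermann lemma -/

section Closed

variable {P : Type*}

/-- Syntactically closed formulas over the variables in `A`: those built from nominals and
variables in `A` without implications and conominals. -/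
inductive XFml.IsSynClosed (A : Set P) : XFml P → Prop
  | var {p} : p ∈ A → XFml.IsSynClosed A (.var p)
  | nom (i) : XFml.IsSynClosed A (.nom i)
  | bot : XFml.IsSynClosed A .bot
  | top : XFml.IsSynClosed A .top
  | and {a b} : XFml.IsSynClosed A a → XFml.IsSynClosed A b → XFml.IsSynClosed A (.and a b)
  | or {a b} : XFml.IsSynClosed A a → XFml.IsSynClosed A b → XFml.IsSynClosed A (.or a b)
  | box {a} : XFml.IsSynClosed A a → XFml.IsSynClosed A (.box a)
  | bdia {a} : XFml.IsSynClosed A a → XFml.IsSynClosed A (.bdia a)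

namespace XFml.IsSynClosed

variable {A : Set P} {a : XFml P}

lemma mono {B : Set P} (hAB : A ⊆ B) (h : a.IsSynClosed A) : a.IsSynClosed B := by
  induction h with
  | var hp => exact .var (hAB hp)
  | nom i => exact .nom i
  | bot => exact .bot
  | top => exact .top
  | and _ _ iha ihb => exact .and iha ihb
  | or _ _ iha ihb => exact .or iha ihb
  | box _ ih => exact .box ih
  | bdia _ ih => exact .bdia ih

lemma positiveIn (h : a.IsSynClosed A) (p : P) : a.PositiveIn p := by
  unfold XFml.PositiveIn
  induction h <;> simp_all [XFml.Occurs]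

lemma mem_of_mentions (h : a.IsSynClosed A) {p : P} (hp : a.Mentions p) : p ∈ A := by
  replace hp : a.Occurs p true := hp.resolve_right (h.positiveIn p)
  induction h with
  | var hq => exact hp.2 ▸ hq
  | nom i => exact hp.elim
  | bot => exact hp.elim
  | top => exact hp.elim
  | and _ _ iha ihb => exact hp.elim iha ihb
  | or _ _ iha ihb => exact hp.elim iha ihb
  | box _ ih => exact ih hp
  | bdia _ ih => exact ih hp

lemma bigOr {l : List (XFml P)} (h : ∀ a ∈ l, a.IsSynClosed A) :
    (XFml.bigOr l).IsSynClosed A := by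
  induction l using XFml.bigOr.induct with
  | case1 => exact .bot
  | case2 a => exact h a (by simp)
  | case3 a b l ih => exact .or (h a (by simp)) (ih fun c hc => h c (by simp_all))

lemma subst {p : P} {θ : XFml P} (hθ : p ∈ A → θ.IsSynClosed A) (h : a.IsSynClosed A) :
    (XFml.subst p θ a).IsSynClosed A := by
  unfold XFml.subst
  induction h with
  | @var q hq =>
    by_cases hqp : q = p
    · subst hqp; simpa [XFml.bind] using hθ hq
    · simpa [XFml.bind, hqp] using IsSynClosed.var hq
  | nom i => exact .nom i
  | bot => exact .bot
  | top => exact .top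
  | and _ _ iha ihb => exact .and iha ihb
  | or _ _ iha ihb => exact .or iha ihb
  | box _ ih => exact .box ih
  | bdia _ ih => exact .bdia ih

lemma truth_mono {X : Type*} {R : X → X → Prop} {V V' : P → Set X} (hV : ∀ p, V p ⊆ V' p)
    (g : IndVar → X) (h : a.IsSynClosed A) : a.truth R V g ⊆ a.truth R V' g := by
  induction h with
  | @var p hp => exact hV p
  | nom i => exact subset_rfl
  | bot => exact subset_rfl
  | top => exact subset_rfl
  | and _ _ iha ihb => exact inter_subset_inter iha ihb
  | or _ _ iha ihb => exact union_subset_union iha ihb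
  | box _ ih => exact fun x hx y hy => ih (hx y hy)
  | bdia _ ih => exact fun x ⟨y, hy, hy'⟩ => ⟨y, hy, ih hy'⟩

variable {X : Type*} [TopologicalSpace X] {K : Set (Set X)} {R : X → X → Prop}

lemma isClosed_truth (hX : IsGenModalSpace K R) {V : P → Set X} (hV : ∀ p, IsClosed (V p))
    (g : IndVar → X) (h : a.IsSynClosed A) : IsClosed (a.truth R V g) := by
  induction h with
  | @var p hp => exact hV p
  | nom i =>
    rw [XFml.truth, ← isOpen_compl_iff, isOpen_iff_forall_mem_open]
    intro x hx
    obtain ⟨U, hU, hxU, hiU⟩ := hX.separates x _ hx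
    exact ⟨U, fun z hz hzi => hiU (hzi ▸ hz), hX.isBasis.isOpen hU, hxU⟩
  | bot => exact isClosed_empty
  | top => exact isClosed_univ
  | and _ _ iha ihb => exact iha.inter ihb
  | or _ _ iha ihb => exact iha.union ihb
  | box _ ih => exact hX.isClosed_box ih
  | bdia _ ih => exact hX.isClosed_bdia ih

/-- Uniformity on compact sets: if each point of a compact set `s` can be kept out of
`a(U)` by some admissible `U ⊇ C`, then one such `U` keeps out all of `s`. -/
lemma exists_admissible_disjoint_compact [DecidableEq P] [Nonempty X]
    (hX : IsGenModalSpace K R) {V : P → Set X}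
    (hV : ∀ p, IsClosed (V p)) (g : IndVar → X) (p : P) {C : Set X} (h : a.IsSynClosed A)
    {s : Set X} (hs : IsCompact s)
    (hpt : ∀ x ∈ s, ∃ U ∈ admissibleSets K, C ⊆ U ∧
      x ∉ a.truth R (Function.update V p U) g) :
    ∃ U ∈ admissibleSets K, C ⊆ U ∧ ∀ x ∈ s, x ∉ a.truth R (Function.update V p U) g := by
  refine hs.induction_on (p := fun s => ∃ U ∈ admissibleSets K, C ⊆ U ∧
      ∀ x ∈ s, x ∉ a.truth R (Function.update V p U) g)
    ⟨univ, hX.univ_mem_admissibleSets, subset_univ _, fun x hx => hx.elim⟩ ?_ ?_ ?_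
  · rintro s t hst ⟨U, hU, hCU, ht⟩
    exact ⟨U, hU, hCU, fun x hx => ht x (hst hx)⟩
  · rintro s t ⟨U, hU, hCU, hUs⟩ ⟨W, hW, hCW, hWt⟩
    have hle : ∀ U' : Set X, U ∩ W ⊆ U' → a.truth R (Function.update V p (U ∩ W)) g ⊆
        a.truth R (Function.update V p U') g := fun U' hU' => h.truth_mono (fun q => by
      by_cases hq : q = p
      · subst hq; simpa using hU'
      · simp [hq]) g
    refine ⟨U ∩ W, hX.inter_mem_admissibleSets hU hW, subset_inter hCU hCW, ?_⟩
    rintro x (hx | hx) hx'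
    exacts [hUs x hx (hle U inter_subset_left hx'), hWt x hx (hle W inter_subset_right hx')]
  · intro x hx
    obtain ⟨U, hU, hCU, hxU⟩ := hpt x hx
    have hcl : IsClosed (a.truth R (Function.update V p U) g) :=
      h.isClosed_truth hX (fun q => by
        by_cases hq : q = p
        · subst hq; simpa using hX.isClosed_of_mem_admissibleSets hU
        · simpa [hq] using hV q) g
    exact ⟨_, mem_nhdsWithin_of_mem_nhds (hcl.isOpen_compl.mem_nhds hxU), U, hU, hCU,
      fun y hy => hy⟩

/-- Syntactically closed formulas preserve the directed intersection of the admissible sets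
that include a closed set `C`. For the black diamond this is Esakia's lemma, by compactness of the set of
predecessors of a point. -/
lemma exists_admissible_notMem_truth [DecidableEq P] (hX : IsGenModalSpace K R) {V : P → Set X}
    (hV : ∀ p, IsClosed (V p)) (g : IndVar → X) (p : P) {C : Set X} (hC : IsClosed C)
    (h : a.IsSynClosed A) {x : X} (hx : x ∉ a.truth R (Function.update V p C) g) :
    ∃ U ∈ admissibleSets K, C ⊆ U ∧ x ∉ a.truth R (Function.update V p U) g := by
  have : Nonempty X := ⟨x⟩
  have huniv : ∃ U ∈ admissibleSets K, C ⊆ U :=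
    ⟨univ, hX.univ_mem_admissibleSets, subset_univ _⟩
  induction h generalizing x with
  | @var q hq =>
    by_cases hqp : q = p
    · subst hqp
      simpa [XFml.truth] using hX.exists_admissible_superset hC (by simpa [XFml.truth] using hx)
    · obtain ⟨U, hU, hCU⟩ := huniv
      exact ⟨U, hU, hCU, by simpa [XFml.truth, hqp] using hx⟩
  | nom i =>
    obtain ⟨U, hU, hCU⟩ := huniv
    exact ⟨U, hU, hCU, hx⟩
  | bot =>
    obtain ⟨U, hU, hCU⟩ := huniv
    exact ⟨U, hU, hCU, hx⟩
  | top => exact (hx trivial).elim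
  | @and b c _ _ iha ihb =>
    by_cases hxa : x ∈ b.truth R (Function.update V p C) g
    · obtain ⟨U, hU, hCU, hxU⟩ := ihb fun hxb => hx ⟨hxa, hxb⟩
      exact ⟨U, hU, hCU, fun hx' => hxU hx'.2⟩
    · obtain ⟨U, hU, hCU, hxU⟩ := iha hxa
      exact ⟨U, hU, hCU, fun hx' => hxU hx'.1⟩
  | or ha hb iha ihb =>
    obtain ⟨U, hU, hCU, hxU⟩ := iha fun hx' => hx (Or.inl hx')
    obtain ⟨W, hW, hCW, hxW⟩ := ihb fun hx' => hx (Or.inr hx')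
    have hle : ∀ U' : Set X, U ∩ W ⊆ U' → ∀ q, Function.update V p (U ∩ W) q ⊆
        Function.update V p U' q := fun U' hU' q => by
      by_cases hq : q = p
      · subst hq; simpa using hU'
      · simp [hq]
    refine ⟨U ∩ W, hX.inter_mem_admissibleSets hU hW, subset_inter hCU hCW, ?_⟩
    rintro (hx' | hx')
    exacts [hxU (ha.truth_mono (hle U inter_subset_left) g hx'),
      hxW (hb.truth_mono (hle W inter_subset_right) g hx')]
  | box ha ih =>
    simp only [XFml.truth, mem_ofPred_eq, not_forall] at hx
    obtain ⟨y, hxy, hy⟩ := hx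
    obtain ⟨U, hU, hCU, hyU⟩ := ih hy
    exact ⟨U, hU, hCU, fun hx' => hyU (hx' y hxy)⟩
  | bdia ha ih =>
    obtain ⟨U, hU, hCU, hU'⟩ := ha.exists_admissible_disjoint_compact hX hV g p (C := C)
      (hX.isCompact_predecessors x) fun y hy => ih fun hy' => hx ⟨y, hy, hy'⟩
    exact ⟨U, hU, hCU, fun ⟨y, hy, hy'⟩ => hU' y hy hy'⟩

/-- The topological core of the Ackermann rule: a closed value `C` of `p` may be enlarged to an
admissible one without violating `a ≤ W`, when `W` has compact complement. -/
lemma exists_admissible_truth_subset [DecidableEq P] [Nonempty X] (hX : IsGenModalSpace K R)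
    {V : P → Set X} (hV : ∀ p, IsClosed (V p)) (g : IndVar → X) (p : P) {C : Set X}
    (hC : IsClosed C) (h : a.IsSynClosed A) {W : Set X} (hW : IsCompact Wᶜ)
    (hsub : a.truth R (Function.update V p C) g ⊆ W) :
    ∃ U ∈ admissibleSets K, C ⊆ U ∧ a.truth R (Function.update V p U) g ⊆ W := by
  obtain ⟨U, hU, hCU, hU'⟩ := h.exists_admissible_disjoint_compact hX hV g p (C := C) hW
    fun x hx => h.exists_admissible_notMem_truth hX hV g p hC fun hx' => hx (hsub hx')
  exact ⟨U, hU, hCU, fun x hx => by_contra fun hxW => hU' x hxW hx⟩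

end XFml.IsSynClosed

end Closed

/-! ### The standard translation -/

section StandardTranslation

open FirstOrder FirstOrder.Language

variable {P X : Type*} (R : X → X → Prop) (V : P → Set X)

lemma realize_accAtom {n : ℕ} (x y : Fin n) (g : IndVar → X) (xs : Fin n → X) :
    letI := corrStructure R V
    (accAtom x y : (corrLang P).BoundedFormula IndVar n).Realize g xs ↔ R (xs x) (xs y) :=
  Iff.rfl

lemma realize_stdTr (a : XFml P) {n : ℕ} (x : Fin n) (g : IndVar → X) (xs : Fin n → X) :
    letI := corrStructure R V
    (stdTr a x).Realize g xs ↔ xs x ∈ a.truth R V g := by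
  let := corrStructure R V
  induction a generalizing n with
  | var p => exact Iff.rfl
  | nom i => simp [stdTr, XFml.truth]
  | conom m => simp [stdTr, XFml.truth]
  | bot => simp [stdTr, XFml.truth]
  | top => simp [stdTr, XFml.truth]
  | and a b iha ihb => simp [stdTr, XFml.truth, iha, ihb]
  | or a b iha ihb => simp [stdTr, XFml.truth, iha, ihb]
  | imp a b iha ihb => simp [stdTr, XFml.truth, iha, ihb]
  | box a ih =>
    simp [stdTr, XFml.truth, ih, realize_accAtom]
  | bdia a ih =>
    simp [stdTr, XFml.truth, ih, realize_accAtom]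

lemma realize_STIneq (e : XIneq P) (g : IndVar → X) :
    letI := corrStructure R V
    (STIneq e).Realize g ↔ e.Holds R V g := by
  let := corrStructure R V
  simp only [STIneq, Formula.Realize, BoundedFormula.realize_all, BoundedFormula.realize_imp,
    realize_stdTr]
  rfl

lemma realize_STQuasi (S : List (XIneq P)) (e : XIneq P) (g : IndVar → X) :
    letI := corrStructure R V
    (STQuasi S e).Realize g ↔ ((∀ e' ∈ S, e'.Holds R V g) → e.Holds R V g) := by
  let := corrStructure R V
  have := realize_STIneq R V (g := g)
  simp only [Formula.Realize] at this
  simp only [STQuasi, Formula.Realize, BoundedFormula.realize_imp,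
    BoundedFormula.realize_foldr_inf, List.forall_mem_map, this]

/-- The free variable is needed when `X` is empty: a universal quantification over no variables
is not vacuous. -/
lemma realize_univClosure (φ : (corrLang P).Formula IndVar) {v : IndVar}
    (hv : v ∈ φ.freeVarFinset) :
    letI := corrStructure R V
    (univClosure φ).Realize X ↔ ∀ g : IndVar → X, φ.Realize g := by
  let := corrStructure R V
  have key : ∀ (i : {v // v ∈ φ.freeVarFinset} → X) (g : IndVar → X), (∀ a, i a = g a) →
      (Formula.Realize (BoundedFormula.restrictFreeVar φ
        (fun v => (Sum.inr v : Empty ⊕ {v // v ∈ φ.freeVarFinset})))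
        (Sum.elim (default : Empty → X) i) ↔ φ.Realize g) := fun i g hg => by
    refine BoundedFormula.realize_restrictFreeVar g ?_
    intro a
    exact hg a
  rw [univClosure, Sentence.Realize, Formula.realize_iAlls]
  constructor
  · intro h g
    exact (key (fun a => g a) g fun _ => rfl).1 (h _)
  · intro h i
    classical
    refine (key i (fun u => if hu : u ∈ φ.freeVarFinset then i ⟨u, hu⟩ else i ⟨v, hv⟩) ?_).2 (h _)
    intro a
    simp

end StandardTranslation

open ALBA in
/-- The output sentence expresses the validity of its quasi-inequalities. -/
lemma foTrue_outputSentence {X : Type*} (R : X → X → Prop) (Q : List (List (XIneq Empty))) :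
    FOTrue R (outputSentence Q) ↔ ∀ T ∈ Q, ∀ g : IndVar → X,
      (∀ e ∈ T, e.Holds R (fun e => e.elim) g) → g (Sum.inl 0) ≠ g (Sum.inr 0) := by
  let := corrStructure R (fun e : Empty => e.elim)
  rw [FOTrue, outputSentence, FirstOrder.Language.Sentence.Realize,
    FirstOrder.Language.Formula.Realize, FirstOrder.Language.BoundedFormula.realize_foldr_inf,
    List.forall_mem_map]
  refine forall₂_congr fun T _ => ?_
  have hfree : (Sum.inl 0 : IndVar) ∈
      (STQuasi T (⟨.nom 0, .conom 0⟩ : XIneq Empty)).freeVarFinset := by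
    simp [STQuasi, STIneq, stdTr, FirstOrder.Language.BoundedFormula.freeVarFinset,
      FirstOrder.Language.Term.bdEqual]
  refine (realize_univClosure R (fun e : Empty => e.elim) _ hfree).trans
    (forall_congr' fun g => ?_)
  rw [realize_STQuasi]
  simp only [XIneq.Holds, XFml.truth, singleton_subset_iff, mem_compl_iff, mem_singleton_iff,
    ne_eq]

/-! ### Exhaustive application of terminating rules -/

namespace ALBA

lemma exists_exhausts {α : Type*} {step : α → α → Prop} (f : α → ℕ)
    (hf : ∀ a b, step a b → f b < f a) (a : α) : ∃ b, Exhausts step a b := by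
  induction h : f a using Nat.strong_induction_on generalizing a with
  | _ n ih =>
    by_cases hs : ∃ c, step a c
    · obtain ⟨c, hc⟩ := hs
      obtain ⟨b, hcb, hb⟩ := ih _ (h ▸ hf a c hc) c rfl
      exact ⟨b, .head hc hcb, hb⟩
    · exact ⟨a, .refl, fun c hc => hs ⟨c, hc⟩⟩

variable {P : Type*} {Ω : P → P → Prop}

/-! ### The first stage: distribution and splitting -/

lemma Rewrite.truth_eq {X : Type*} {R : X → X → Prop} {V : P → Set X}
    {rule : Fml P → Fml P → Prop} (hr : ∀ a b, rule a b → a.truth R V = b.truth R V)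
    {a b : Fml P} (h : Rewrite rule a b) : a.truth R V = b.truth R V := by
  induction h with
  | root h => exact hr _ _ h
  | _ => simp_all [Fml.truth]

lemma AntRule.truth_eq {X : Type*} (R : X → X → Prop) (V : P → Set X) (a b : Fml P)
    (h : AntRule a b) : a.truth R V = b.truth R V := by
  cases h
  · exact inter_union_distrib_left _ _ _
  · exact union_inter_distrib_right _ _ _

lemma SucRule.truth_eq {X : Type*} (R : X → X → Prop) (V : P → Set X) (a b : Fml P)
    (h : SucRule a b) : a.truth R V = b.truth R V := by
  cases h
  · ext; simp [Fml.truth, _root_.imp_and]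
  · ext; simp [Fml.truth, _root_.imp_and, forall_and]
  · exact union_inter_distrib_left _ _ _
  · exact inter_union_distrib_right _ _ _

lemma truth_eq_of_reflTransGen {X : Type*} {R : X → X → Prop} {V : P → Set X}
    {rule : Fml P → Fml P → Prop} (hr : ∀ a b, rule a b → a.truth R V = b.truth R V)
    {a b : Fml P} (h : Relation.ReflTransGen (Rewrite rule) a b) :
    a.truth R V = b.truth R V := by
  induction h with
  | refl => rfl
  | tail _ h ih => exact ih.trans (h.truth_eq hr)

/-- A polynomial interpretation under which the distribution rules for antecedents decrease. -/
def antMeasure : Fml P → ℕ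
  | .var _ | .top => 2
  | .imp a b => antMeasure a + antMeasure b
  | .and a b => antMeasure a * antMeasure b
  | .or a b => antMeasure a + antMeasure b + 1
  | .box a => antMeasure a + 1

/-- A polynomial interpretation under which the distribution rules for succedents decrease. -/
def sucMeasure : Fml P → ℕ
  | .var _ | .top => 2
  | .imp a b => sucMeasure a * sucMeasure b
  | .and a b => sucMeasure a + sucMeasure b + 1
  | .or a b => sucMeasure a * sucMeasure b
  | .box a => 2 * sucMeasure a

lemma two_le_antMeasure (a : Fml P) : 2 ≤ antMeasure a := by
  induction a <;> simp only [antMeasure] <;> nlinarith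

lemma two_le_sucMeasure (a : Fml P) : 2 ≤ sucMeasure a := by
  induction a <;> simp only [sucMeasure] <;> nlinarith

lemma antMeasure_lt {a b : Fml P} (h : Rewrite AntRule a b) : antMeasure b < antMeasure a := by
  induction h with
  | root h =>
    cases h with
    | and_or a b c | or_and a b c =>
      have := two_le_antMeasure a
      simp only [antMeasure]
      nlinarith
  | and_left b _ ih =>
    exact Nat.mul_lt_mul_of_pos_right ih (by have := two_le_antMeasure b; omega)
  | and_right a _ ih =>
    exact Nat.mul_lt_mul_of_pos_left ih (by have := two_le_antMeasure a; omega)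
  | _ => simp only [antMeasure]; omega

lemma sucMeasure_lt {a b : Fml P} (h : Rewrite SucRule a b) : sucMeasure b < sucMeasure a := by
  induction h with
  | root h =>
    cases h with
    | imp_and a b c | or_and a b c | and_or a b c =>
      have := two_le_sucMeasure a
      simp only [sucMeasure]
      nlinarith
    | box_and a b => simp only [sucMeasure]; omega
  | imp_left b _ ih | or_left b _ ih =>
    exact Nat.mul_lt_mul_of_pos_right ih (by have := two_le_sucMeasure b; omega)
  | imp_right a _ ih | or_right a _ ih =>
    exact Nat.mul_lt_mul_of_pos_left ih (by have := two_le_sucMeasure a; omega)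
  | _ => simp only [sucMeasure]; omega

lemma AntRule.isPos {A : Set P} {a b : Fml P} (h : AntRule a b) (ha : IsPos A a) :
    IsPos A b := by
  cases h
  · cases ha with | and ha hb => cases hb with | or hb hc => exact .or (.and ha hb) (.and ha hc)
  · cases ha with | and hb ha => cases hb with | or hb hc => exact .or (.and hb ha) (.and hc ha)

lemma SucRule.isPos {A : Set P} {a b : Fml P} (h : SucRule a b) (ha : IsPos A a) :
    IsPos A b := by
  cases h
  · cases ha
  · cases ha with | box ha => cases ha with | and ha hb => exact .and (.box ha) (.box hb)
  · cases ha with | or ha hb => cases hb with | and hb hc => exact .and (.or ha hb) (.or ha hc)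
  · cases ha with | or hb ha => cases hb with | and hb hc => exact .and (.or hb ha) (.or hc ha)

lemma AntRule.not_isPIA {p : P} {a b : Fml P} (h : AntRule a b) : ¬ IsPIA Ω p a := by
  cases h <;> intro h <;> cases h

lemma SucRule.not_isPIA {p : P} {a b : Fml P} (h : SucRule a b) : ¬ IsPIA Ω p a := by
  cases h
  · intro h; cases h with | imp _ h => cases h
  · intro h; cases h with | box h => cases h
  · intro h; cases h
  · intro h; cases h

lemma Rewrite.isPos {rule : Fml P → Fml P → Prop} {A : Set P}
    (hr : ∀ {a b}, rule a b → IsPos A a → IsPos A b) {a b : Fml P} (h : Rewrite rule a b)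
    (ha : IsPos A a) : IsPos A b := by
  induction h with
  | root h => exact hr h ha
  | imp_left | imp_right => cases ha
  | and_left _ _ ih => cases ha with | and ha hb => exact .and (ih ha) hb
  | and_right _ _ ih => cases ha with | and ha hb => exact .and ha (ih hb)
  | or_left _ _ ih => cases ha with | or ha hb => exact .or (ih ha) hb
  | or_right _ _ ih => cases ha with | or ha hb => exact .or ha (ih hb)
  | box _ ih => cases ha with | box ha => exact .box (ih ha)

/-- Rewriting a PIA-formula takes place inside the positive antecedents of its implications. -/
lemma Rewrite.isPIA {rule : Fml P → Fml P → Prop} {p : P}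
    (hr : ∀ {A : Set P} {a b}, rule a b → IsPos A a → IsPos A b)
    (hr' : ∀ {a b}, rule a b → ¬ IsPIA Ω p a) {a b : Fml P} (h : Rewrite rule a b)
    (ha : IsPIA Ω p a) : IsPIA Ω p b := by
  induction h with
  | root h => exact (hr' h ha).elim
  | imp_left _ h _ => cases ha with | imp ha hb => exact .imp (h.isPos hr ha) hb
  | imp_right _ _ ih => cases ha with | imp ha hb => exact .imp ha (ih hb)
  | and_left | and_right | or_left | or_right => cases ha
  | box _ ih => cases ha with | box ha => exact .box (ih ha)

lemma Rewrite.isAnt {a b : Fml P} (h : Rewrite AntRule a b) (ha : IsAnt Ω a) : IsAnt Ω b := by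
  induction h with
  | root h =>
    cases ha with
    | pia ha => exact (h.not_isPIA ha).elim
    | and ha hb =>
      cases h
      · cases hb with
        | pia hb => cases hb
        | or hb hc => exact .or (.and ha hb) (.and ha hc)
      · cases ha with
        | pia ha => cases ha
        | or ha hc => exact .or (.and ha hb) (.and hc hb)
    | or => cases h
  | imp_left _ h _ =>
    cases ha with | pia ha => exact .pia ((h.imp_left _).isPIA AntRule.isPos AntRule.not_isPIA ha)
  | imp_right _ h _ =>
    cases ha with | pia ha => exact .pia ((h.imp_right _).isPIA AntRule.isPos AntRule.not_isPIA ha)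
  | box h _ =>
    cases ha with | pia ha => exact .pia (h.box.isPIA AntRule.isPos AntRule.not_isPIA ha)
  | and_left _ _ ih =>
    cases ha with
    | pia ha => cases ha
    | and ha hb => exact .and (ih ha) hb
  | and_right _ _ ih =>
    cases ha with
    | pia ha => cases ha
    | and ha hb => exact .and ha (ih hb)
  | or_left _ _ ih =>
    cases ha with
    | pia ha => cases ha
    | or ha hb => exact .or (ih ha) hb
  | or_right _ _ ih =>
    cases ha with
    | pia ha => cases ha
    | or ha hb => exact .or ha (ih hb)

lemma Rewrite.isSuc {a b : Fml P} (h : Rewrite SucRule a b) (ha : IsSuc Ω a) : IsSuc Ω b := by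
  induction h with
  | root h =>
    cases h
    · cases ha with
      | imp ha hb => cases hb with | and hb hc => exact .and (.imp ha hb) (.imp ha hc)
    · cases ha with | box ha => cases ha with | and ha hb => exact .and (.box ha) (.box hb)
    · cases ha with | or ha hb => cases hb with | and hb hc => exact .and (.or ha hb) (.or ha hc)
    · cases ha with | or hb ha => cases hb with | and hb hc => exact .and (.or hb ha) (.or hc ha)
  | imp_left _ h _ =>
    cases ha with | imp ha hb => exact .imp (h.isPIA SucRule.isPos SucRule.not_isPIA ha) hb
  | imp_right _ _ ih => cases ha with | imp ha hb => exact .imp ha (ih hb)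
  | and_left _ _ ih => cases ha with | and ha hb => exact .and (ih ha) hb
  | and_right _ _ ih => cases ha with | and ha hb => exact .and ha (ih hb)
  | or_left _ _ ih => cases ha with | or ha hb => exact .or (ih ha) hb
  | or_right _ _ ih => cases ha with | or ha hb => exact .or ha (ih hb)
  | box _ ih => cases ha with | box ha => exact .box (ih ha)

/-- Conjunctions of PIA-formulas: the disjuncts of a distributed inductive antecedent. -/
inductive IsConjPIA (Ω : P → P → Prop) : Fml P → Prop
  | pia {p a} : IsPIA Ω p a → IsConjPIA Ω a
  | and {a b} : IsConjPIA Ω a → IsConjPIA Ω b → IsConjPIA Ω (.and a b)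

/-- Inductive succedents built without conjunction: the conjuncts of a distributed inductive
succedent. -/
inductive IsFlatSuc (Ω : P → P → Prop) : Fml P → Prop
  | var {p} : IsFlatSuc Ω (.var p)
  | top : IsFlatSuc Ω .top
  | imp {q a b} : IsPIA Ω q a → IsFlatSuc Ω b → IsFlatSuc Ω (.imp a b)
  | box {a} : IsFlatSuc Ω a → IsFlatSuc Ω (.box a)
  | or {a b} : IsFlatSuc Ω a → IsFlatSuc Ω b → IsFlatSuc Ω (.or a b)

lemma isConjPIA_of_isAnt {a : Fml P} (ha : IsAnt Ω a) (hn : ∀ c, ¬ Rewrite AntRule a c)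
    (hor : ∀ b c, a ≠ .or b c) : IsConjPIA Ω a := by
  induction ha with
  | pia h => exact .pia h
  | and _ _ iha ihb =>
    refine .and (iha (fun c hc => hn _ (hc.and_left _)) ?_)
      (ihb (fun c hc => hn _ (hc.and_right _)) ?_)
    · rintro b c rfl
      exact hn _ (.root (.or_and _ _ _))
    · rintro b c rfl
      exact hn _ (.root (.and_or _ _ _))
  | or => exact (hor _ _ rfl).elim

lemma isFlatSuc_of_isSuc {a : Fml P} (ha : IsSuc Ω a) (hn : ∀ c, ¬ Rewrite SucRule a c)
    (hand : ∀ b c, a ≠ .and b c) : IsFlatSuc Ω a := by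
  induction ha with
  | var => exact .var
  | top => exact .top
  | imp h _ ih =>
    refine .imp h (ih (fun c hc => hn _ (hc.imp_right _)) ?_)
    rintro b c rfl
    exact hn _ (.root (.imp_and _ _ _))
  | box _ ih =>
    refine .box (ih (fun c hc => hn _ hc.box) ?_)
    rintro b c rfl
    exact hn _ (.root (.box_and _ _))
  | and => exact (hand _ _ rfl).elim
  | or _ _ iha ihb =>
    refine .or (iha (fun c hc => hn _ (hc.or_left _)) ?_)
      (ihb (fun c hc => hn _ (hc.or_right _)) ?_)
    · rintro b c rfl
      exact hn _ (.root (.and_or _ _ _))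
    · rintro b c rfl
      exact hn _ (.root (.or_and _ _ _))

/-- The property of pairs `(φ, ψ)` which splitting preserves: `φ` is a distributed inductive
antecedent and `ψ` a distributed inductive succedent. -/
def IsDistributed (Ω : P → P → Prop) (e : Fml P × Fml P) : Prop :=
  (IsAnt Ω e.1 ∧ ∀ c, ¬ Rewrite AntRule e.1 c) ∧ IsSuc Ω e.2 ∧ ∀ c, ¬ Rewrite SucRule e.2 c

lemma SplitStep.isDistributed {L L' : List (Fml P × Fml P)} (h : SplitStep L L')
    (hL : ∀ e ∈ L, IsDistributed Ω e) : ∀ e ∈ L', IsDistributed Ω e := by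
  cases h with
  | and S T a b c =>
    obtain ⟨ha, hs, hn⟩ := hL (a, .and b c) (by simp)
    cases hs with
    | and hb hc =>
      intro e he
      simp only [List.mem_append, List.mem_cons] at he
      rcases he with he | rfl | rfl | he
      · exact hL e (by simp [he])
      · exact ⟨ha, hb, fun d hd => hn _ (hd.and_left _)⟩
      · exact ⟨ha, hc, fun d hd => hn _ (hd.and_right _)⟩
      · exact hL e (by simp [he])
  | or S T a b c =>
    obtain ⟨⟨hs, hn⟩, hc⟩ := hL (.or a b, c) (by simp)
    cases hs with
    | pia h => cases h
    | or ha hb =>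
      intro e he
      simp only [List.mem_append, List.mem_cons] at he
      rcases he with he | rfl | rfl | he
      · exact hL e (by simp [he])
      · exact ⟨⟨ha, fun d hd => hn _ (hd.or_left _)⟩, hc⟩
      · exact ⟨⟨hb, fun d hd => hn _ (hd.or_right _)⟩, hc⟩
      · exact hL e (by simp [he])

lemma SplitStep.truth_subset_iff {X : Type*} {R : X → X → Prop} {V : P → Set X}
    {L L' : List (Fml P × Fml P)} (h : SplitStep L L') :
    (∀ e ∈ L, e.1.truth R V ⊆ e.2.truth R V) ↔ ∀ e ∈ L', e.1.truth R V ⊆ e.2.truth R V := by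
  cases h with
  | and S T a b c =>
    simp only [List.forall_mem_append, List.forall_mem_cons, Fml.truth, subset_inter_iff, and_assoc]
  | or S T a b c =>
    simp only [List.forall_mem_append, List.forall_mem_cons, Fml.truth, union_subset_iff, and_assoc]

end ALBA

/-! ### Occurrences of variables and substitution -/

namespace XFml

variable {P : Type*}

lemma finite_noms (a : XFml P) : a.noms.Finite := by
  induction a <;> simp_all [noms]

lemma finite_conoms (a : XFml P) : a.conoms.Finite := by
  induction a <;> simp_all [conoms]

lemma finite_setOf_mentions (a : XFml P) : {p | a.Mentions p}.Finite := by
  induction a with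
  | var q =>
    exact (finite_singleton q).subset fun p hp => by
      rcases hp with hp | hp
      exacts [hp.2.symm, nomatch hp.1]
  | nom i | conom m | bot | top => simp [Mentions, Occurs]
  | and a b iha ihb | or a b iha ihb =>
    exact (iha.union ihb).subset fun p hp => by
      rcases hp with (hp | hp) | (hp | hp)
      exacts [.inl (.inl hp), .inr (.inl hp), .inl (.inr hp), .inr (.inr hp)]
  | imp a b iha ihb =>
    exact (iha.union ihb).subset fun p hp => by
      rcases hp with (hp | hp) | (hp | hp)
      exacts [.inl (.inr hp), .inr (.inl hp), .inl (.inl hp), .inr (.inr hp)]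
  | box a ih | bdia a ih => exact ih

lemma mentions_and {a b : XFml P} {p : P} :
    (XFml.and a b).Mentions p ↔ a.Mentions p ∨ b.Mentions p := by
  simp only [Mentions, Occurs]; tauto

lemma mentions_or {a b : XFml P} {p : P} :
    (XFml.or a b).Mentions p ↔ a.Mentions p ∨ b.Mentions p := by
  simp only [Mentions, Occurs]; tauto

lemma mentions_imp {a b : XFml P} {p : P} :
    (XFml.imp a b).Mentions p ↔ a.Mentions p ∨ b.Mentions p := by
  simp only [Mentions, Occurs, Bool.not_true, Bool.not_false]; tauto

lemma mentions_var {p q : P} : (XFml.var q).Mentions p ↔ q = p := by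
  simp [Mentions, Occurs]

lemma subst_of_not_mentions {p : P} {θ a : XFml P} (h : ¬ a.Mentions p) :
    XFml.subst p θ a = a := by
  unfold XFml.subst
  induction a with
  | var q => simp [bind, mentions_var.not.1 h]
  | nom i | conom m | bot | top => rfl
  | and a b iha ihb =>
    rw [mentions_and, not_or] at h
    simp [bind, iha h.1, ihb h.2]
  | or a b iha ihb =>
    rw [mentions_or, not_or] at h
    simp [bind, iha h.1, ihb h.2]
  | imp a b iha ihb =>
    rw [mentions_imp, not_or] at h
    simp [bind, iha h.1, ihb h.2]
  | box a ih | bdia a ih => exact congrArg _ (ih h)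

lemma mentions_of_mentions_subst {p q : P} {θ a : XFml P}
    (h : (XFml.subst p θ a).Mentions q) : θ.Mentions q ∨ (a.Mentions q ∧ q ≠ p) := by
  unfold XFml.subst at h
  induction a with
  | var r =>
    by_cases hr : r = p
    · left; simpa [bind, hr] using h
    · right
      have hrq : r = q := by simpa [bind, hr, mentions_var] using h
      exact ⟨mentions_var.2 hrq, hrq ▸ hr⟩
  | nom i | conom m | bot | top => simp [bind, Mentions, Occurs] at h
  | and a b iha ihb =>
    rw [bind, mentions_and] at h
    rw [mentions_and]
    tauto
  | or a b iha ihb =>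
    rw [bind, mentions_or] at h
    rw [mentions_or]
    tauto
  | imp a b iha ihb =>
    rw [bind, mentions_imp] at h
    rw [mentions_imp]
    tauto
  | box a ih | bdia a ih => exact ih h

lemma exists_ofPure_eq {a : XFml P} (h : ∀ p, ¬ a.Mentions p) : ∃ b, ofPure b = a := by
  induction a with
  | var q => exact (h q (mentions_var.2 rfl)).elim
  | nom i => exact ⟨.nom i, rfl⟩
  | conom i => exact ⟨.conom i, rfl⟩
  | bot => exact ⟨.bot, rfl⟩
  | top => exact ⟨.top, rfl⟩
  | and a b iha ihb =>
    simp only [mentions_and, not_or] at h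
    obtain ⟨a, rfl⟩ := iha fun p => (h p).1
    obtain ⟨b, rfl⟩ := ihb fun p => (h p).2
    exact ⟨.and a b, rfl⟩
  | or a b iha ihb =>
    simp only [mentions_or, not_or] at h
    obtain ⟨a, rfl⟩ := iha fun p => (h p).1
    obtain ⟨b, rfl⟩ := ihb fun p => (h p).2
    exact ⟨.or a b, rfl⟩
  | imp a b iha ihb =>
    simp only [mentions_imp, not_or] at h
    obtain ⟨a, rfl⟩ := iha fun p => (h p).1
    obtain ⟨b, rfl⟩ := ihb fun p => (h p).2
    exact ⟨.imp a b, rfl⟩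
  | box a ih =>
    obtain ⟨a, rfl⟩ := ih h
    exact ⟨.box a, rfl⟩
  | bdia a ih =>
    obtain ⟨a, rfl⟩ := ih h
    exact ⟨.bdia a, rfl⟩

end XFml

lemma IsPos.isSynClosed {P : Type*} {A : Set P} {a : Fml P} (h : IsPos A a) :
    a.toX.IsSynClosed A := by
  induction h with
  | var hp => exact .var hp
  | top => exact .top
  | box _ ih => exact .box ih
  | and _ _ iha ihb => exact .and iha ihb
  | or _ _ iha ihb => exact .or iha ihb

namespace ALBA

variable {P : Type*} {Ω : P → P → Prop}

/-! ### The second stage: reduction of systems -/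

/-- The shapes of the inequalities that occur in the second stage before the Ackermann rule. -/
inductive IsTame (Ω : P → P → Prop) : XIneq P → Prop
  | ant (i) {a} : IsConjPIA Ω a → IsTame Ω ⟨.nom i, a.toX⟩
  | pia {θ p a} : θ.IsSynClosed {q | Ω q p} → IsPIA Ω p a → IsTame Ω ⟨θ, a.toX⟩
  | suc {a} (m) : IsFlatSuc Ω a → IsTame Ω ⟨a.toX, .conom m⟩
  | box (n m) : IsTame Ω ⟨.box (.conom n), .conom m⟩
  | imp (j n m) : IsTame Ω ⟨.imp (.nom j) (.conom n), .conom m⟩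

lemma toX_ne_conom (a : Fml P) (k : ℕ) : a.toX ≠ .conom k := by
  cases a <;> simp [Fml.toX]

lemma toX_ne_nom (a : Fml P) (k : ℕ) : a.toX ≠ .nom k := by
  cases a <;> simp [Fml.toX]

/-- The cases in which the local rules apply to a left-hand side that is syntactically closed and
a right-hand side that is a PIA-formula. -/
lemma LocalRule.isTame_of_isPIA {S : List (XIneq P)} {θ : XFml P} {p : P} {a : Fml P}
    {l : List (XIneq P)} (h : LocalRule S ⟨θ, a.toX⟩ l) (hθ : θ.IsSynClosed {q | Ω q p})
    (ha : IsPIA Ω p a) : ∀ e ∈ l, IsTame Ω e := by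
  by_cases hor : ∃ b c, θ = .or b c ∧ l = [⟨b, a.toX⟩, ⟨c, a.toX⟩]
  · obtain ⟨b, c, rfl, rfl⟩ := hor
    cases hθ with
    | or hb hc => simp [IsTame.pia hb ha, IsTame.pia hc ha]
  · cases ha with
    | var =>
      simp only [Fml.toX] at h hor
      cases h
      exact (hor ⟨_, _, rfl, rfl⟩).elim
    | top =>
      simp only [Fml.toX] at h hor
      cases h
      · exact (hor ⟨_, _, rfl, rfl⟩).elim
      · simp
    | box ha =>
      simp only [Fml.toX] at h hor
      cases h
      · exact (hor ⟨_, _, rfl, rfl⟩).elim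
      · simp [IsTame.pia (.bdia hθ) ha]
    | imp hb ha =>
      simp only [Fml.toX] at h hor
      cases h
      · exact (hor ⟨_, _, rfl, rfl⟩).elim
      · simp [IsTame.pia (.and hθ hb.isSynClosed) ha]

lemma LocalRule.isTame {S : List (XIneq P)} {e : XIneq P} {l : List (XIneq P)}
    (h : LocalRule S e l) (he : IsTame Ω e) : ∀ e' ∈ l, IsTame Ω e' := by
  cases he with
  | ant i ha =>
    cases ha with
    | pia ha => exact h.isTame_of_isPIA (.nom i) ha
    | and ha hb =>
      simp only [Fml.toX] at h
      cases h
      simp [IsTame.ant i ha, IsTame.ant i hb]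
  | pia hθ ha => exact h.isTame_of_isPIA hθ ha
  | suc m ha =>
    cases ha with
    | var | top =>
      simp only [Fml.toX] at h
      cases h
    | imp ha hb =>
      simp only [Fml.toX] at h
      cases h
      simp [IsTame.ant _ (.pia ha), IsTame.suc _ hb, IsTame.imp]
    | box ha =>
      simp only [Fml.toX] at h
      cases h
      simp [IsTame.suc _ ha, IsTame.box]
    | or ha hb =>
      simp only [Fml.toX] at h
      cases h
      simp [IsTame.suc _ ha, IsTame.suc _ hb]
  | box n m =>
    cases h with
    | approx_box _ _ _ hne => exact (hne n rfl).elim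
  | imp j n m =>
    cases h with
    | approx_imp _ _ _ _ _ hne => exact (hne ⟨j, n, rfl, rfl⟩).elim

lemma ReduceStep.isTame {S S' : List (XIneq P)} (h : ReduceStep S S')
    (hS : ∀ e ∈ S, IsTame Ω e) : ∀ e ∈ S', IsTame Ω e := by
  cases h with
  | mk S T e l h =>
    intro e' he'
    simp only [List.mem_append] at he'
    rcases he' with (he' | he') | he'
    · exact hS e' (by simp [he'])
    · exact h.isTame (hS e (by simp)) e' he'
    · exact hS e' (by simp [he'])

section Soundness

variable {X : Type*} {R : X → X → Prop} {V : P → Set X}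

lemma LocalRule.holds_of_forall {S : List (XIneq P)} {e : XIneq P} {l : List (XIneq P)}
    (h : LocalRule S e l) {g : IndVar → X} (hl : ∀ e' ∈ l, e'.Holds R V g) : e.Holds R V g := by
  cases h with
  | split_and a b c =>
    simp only [List.forall_mem_cons, XIneq.Holds] at hl
    exact subset_inter hl.1 hl.2.1
  | split_or a b c =>
    simp only [List.forall_mem_cons, XIneq.Holds] at hl
    exact union_subset hl.1 hl.2.1
  | resid_box a b =>
    simp only [List.forall_mem_cons, XIneq.Holds] at hl
    exact fun x hx y hxy => hl.1 ⟨x, hxy, hx⟩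
  | resid_imp a b c =>
    simp only [List.forall_mem_cons, XIneq.Holds] at hl
    exact fun x hx hb => hl.1 ⟨hx, hb⟩
  | approx_box a m n =>
    simp only [List.forall_mem_cons, XIneq.Holds] at hl
    exact fun x hx => hl.2.1 fun y hxy => hl.1 (hx y hxy)
  | approx_imp a b m j n =>
    simp only [List.forall_mem_cons, XIneq.Holds] at hl
    exact fun x hx => hl.2.2.1 fun hj => hl.2.1 (hx (hl.1 hj))
  | delete a => exact subset_univ _

lemma truth_update_nom {j : ℕ} {a : XFml P} (hj : j ∉ a.noms) (g : IndVar → X) (x : X) :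
    a.truth R V (Function.update g (Sum.inl j) x) = a.truth R V g :=
  XFml.truth_congr (fun _ _ => rfl)
    (fun i hi => Function.update_of_ne (by rintro ⟨⟩; exact hj hi) _ _)
    fun _ _ => Function.update_of_ne (by simp) _ _

lemma truth_update_conom {n : ℕ} {a : XFml P} (hn : n ∉ a.conoms) (g : IndVar → X) (x : X) :
    a.truth R V (Function.update g (Sum.inr n) x) = a.truth R V g :=
  XFml.truth_congr (fun _ _ => rfl) (fun _ _ => Function.update_of_ne (by simp) _ _)
    fun m hm => Function.update_of_ne (by rintro ⟨⟩; exact hn hm) _ _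

/-- A solution of a system can be changed on the fresh nominals and conominals so as to satisfy
the inequalities that a local rule introduces. -/
lemma LocalRule.exists_solution {S : List (XIneq P)} {e : XIneq P} {l : List (XIneq P)}
    (h : LocalRule S e l) (he : e ∈ S) {g : IndVar → X} (hS : ∀ e' ∈ S, e'.Holds R V g) :
    ∃ g' : IndVar → X, g' (Sum.inl 0) = g (Sum.inl 0) ∧ g' (Sum.inr 0) = g (Sum.inr 0) ∧
      (∀ e' ∈ S, e'.Holds R V g') ∧ ∀ e' ∈ l, e'.Holds R V g' := by
  have heg := hS e he
  cases h with
  | split_and a b c =>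
    simp only [XIneq.Holds, XFml.truth, subset_inter_iff] at heg
    exact ⟨g, rfl, rfl, hS, by simpa [XIneq.Holds] using heg⟩
  | split_or a b c =>
    simp only [XIneq.Holds, XFml.truth, union_subset_iff] at heg
    exact ⟨g, rfl, rfl, hS, by simpa [XIneq.Holds] using heg⟩
  | resid_box a b =>
    refine ⟨g, rfl, rfl, hS, ?_⟩
    simp only [List.forall_mem_singleton]
    exact fun x ⟨y, hyx, hy⟩ => heg hy x hyx
  | resid_imp a b c =>
    refine ⟨g, rfl, rfl, hS, ?_⟩
    simp only [List.forall_mem_singleton]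
    exact fun x ⟨hx, hx'⟩ => heg hx hx'
  | approx_box a m n _ hn =>
    -- The new conominal names a successor of `m` which refutes `a`.
    obtain ⟨y, hy, hya⟩ : ∃ y, R (g (Sum.inr m)) y ∧ y ∉ a.truth R V g := by
      by_contra! hcon
      exact heg hcon rfl
    have hmn : m ≠ n := fun hmn => (hn.2 _ he).2 hmn.symm
    refine ⟨Function.update g (Sum.inr n) y, by simp, by simp [hn.1.symm], fun e' he' => ?_, ?_⟩
    · rw [XIneq.Holds, truth_update_conom (hn.2 e' he').1, truth_update_conom (hn.2 e' he').2]
      exact hS e' he'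
    · have ha := truth_update_conom (R := R) (V := V) (a := a) (hn.2 _ he).1 g y
      simp only [List.forall_mem_cons, XIneq.Holds, XFml.truth, ha, Function.update_self]
      refine ⟨fun z hz hzy => hya (hzy ▸ hz), ?_, by simp⟩
      rintro z hz rfl
      rw [Function.update_of_ne (by simpa using hmn)] at hz
      exact hz y hy rfl
  | approx_imp a b m j n _ hj hn =>
    -- The new nominal and the new conominal both name `m`, which refutes the implication.
    have hx : g (Sum.inr m) ∈ a.truth R V g ∧ g (Sum.inr m) ∉ b.truth R V g := by
      by_contra! hcon
      exact heg hcon rfl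
    have hmn : m ≠ n := fun hmn => (hn.2 _ he).2 hmn.symm
    set x := g (Sum.inr m) with hxm
    have hupd : ∀ c : XFml P, j ∉ c.noms → n ∉ c.conoms →
        c.truth R V (Function.update (Function.update g (Sum.inl j) x) (Sum.inr n) x) =
          c.truth R V g := fun c hcj hcn =>
      (truth_update_conom hcn _ x).trans (truth_update_nom hcj g x)
    have hje := hj.2 _ he
    have hne := hn.2 _ he
    refine ⟨Function.update (Function.update g (Sum.inl j) x) (Sum.inr n) x,
      by simp [hj.1.symm], by simp [hn.1.symm], fun e' he' => ?_, ?_⟩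
    · rw [XIneq.Holds, hupd _ (hj.2 e' he').1 (hn.2 e' he').1,
        hupd _ (hj.2 e' he').2 (hn.2 e' he').2]
      exact hS e' he'
    · have ha := hupd a (fun h => hje.1 (.inl h)) (fun h => hne.1 (.inl h))
      have hb := hupd b (fun h => hje.1 (.inr h)) (fun h => hne.1 (.inr h))
      simp only [List.forall_mem_cons, XIneq.Holds, XFml.truth, ha, hb]
      refine ⟨?_, ?_, ?_, by simp⟩
      · simpa using hx.1
      · simpa using hx.2
      · rw [Function.update_of_ne (a := Sum.inr m) (by simpa using hmn)]
        rintro z hz rfl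
        exact hz (by simp [hxm]) (by simp [hxm])
  | delete a => exact ⟨g, rfl, rfl, hS, by simp⟩

lemma ReduceStep.quasiValid_iff {K : Set (Set X)} {S S' : List (XIneq P)} (h : ReduceStep S S') :
    QuasiValid K R S ↔ QuasiValid K R S' := by
  cases h with
  | mk S T e l h =>
    refine forall₂_congr fun V _ => ⟨fun H g hg => H g fun e' he' => ?_, fun H g hg => ?_⟩
    · simp only [List.mem_append, List.mem_cons] at he' hg
      rcases he' with he' | rfl | he'
      · exact hg _ (by simp [he'])
      · exact h.holds_of_forall fun e'' he'' => hg _ (by simp [he''])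
      · exact hg _ (by simp [he'])
    · obtain ⟨g', h0, h0', hg', hl⟩ := h.exists_solution (by simp) hg
      rw [← h0, ← h0']
      refine H g' fun e' he' => ?_
      simp only [List.mem_append] at he'
      rcases he' with (he' | he') | he'
      · exact hg' _ (by simp [he'])
      · exact hl _ he'
      · exact hg' _ (by simp [he'])

end Soundness

/-! ### Termination of the reduction of systems -/

/-- The weight of a right-hand side: it counts the outermost connectives that splitting and
residuation can remove. -/
def rhsWeight : XFml P → ℕ
  | .and a b => rhsWeight a + rhsWeight b + 1
  | .imp _ b => rhsWeight b + 1
  | .box a => rhsWeight a + 1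
  | _ => 1

/-- The weight of `□a` as a left-hand side, where `k` is the weight of `a`. The inequalities
`□n ≤ m`, to which no rule applies, get the least weight. -/
def boxWeight : XFml P → ℕ → ℕ
  | .conom _, _ => 1
  | _, k => k + 2

/-- The weight of `a → b` as a left-hand side, where `k` is the weight of `a` as a right-hand
side plus that of `b` as a left-hand side. The inequalities `j → n ≤ m`, to which no rule applies,
get the least weight. -/
def impWeight : XFml P → XFml P → ℕ → ℕ
  | .nom _, .conom _, _ => 1
  | _, _, k => k + 2

/-- The weight of a left-hand side: it counts the outermost connectives that splitting and
approximation can remove. -/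
def lhsWeight : XFml P → ℕ
  | .or a b => lhsWeight a + lhsWeight b + 1
  | .imp a b => impWeight a b (rhsWeight a + lhsWeight b)
  | .box a => boxWeight a (lhsWeight a)
  | _ => 1

/-- The weight of a system. Weights of the two sides are multiplied, because splitting one side
duplicates the other. -/
def systemWeight (S : List (XIneq P)) : ℕ :=
  (S.map fun e => lhsWeight e.lhs * rhsWeight e.rhs).sum

lemma rhsWeight_pos (a : XFml P) : 0 < rhsWeight a := by
  cases a <;> simp [rhsWeight]

lemma boxWeight_eq {a : XFml P} (h : ∀ k, a ≠ .conom k) (k : ℕ) : boxWeight a k = k + 2 := by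
  cases a <;> simp_all [boxWeight]

lemma impWeight_eq {a b : XFml P} (h : ¬ ∃ i k, a = .nom i ∧ b = .conom k) (k : ℕ) :
    impWeight a b k = k + 2 := by
  cases a <;> cases b <;> simp_all [impWeight]

lemma lhsWeight_pos (a : XFml P) : 0 < lhsWeight a := by
  cases a with
  | imp a b =>
    by_cases h : ∃ i k, a = .nom i ∧ b = .conom k
    · obtain ⟨i, k, rfl, rfl⟩ := h
      simp [lhsWeight, impWeight]
    · simp [lhsWeight, impWeight_eq h]
  | box a =>
    by_cases h : ∃ k, a = .conom k
    · obtain ⟨k, rfl⟩ := h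
      simp [lhsWeight, boxWeight]
    · simp [lhsWeight, boxWeight_eq (not_exists.1 h)]
  | _ => simp [lhsWeight]

lemma systemWeight_append (S T : List (XIneq P)) :
    systemWeight (S ++ T) = systemWeight S + systemWeight T := by
  simp [systemWeight]

lemma LocalRule.systemWeight_lt {S : List (XIneq P)} {e : XIneq P} {l : List (XIneq P)}
    (h : LocalRule S e l) : systemWeight l < systemWeight [e] := by
  cases h with
  | split_and a b c =>
    have := lhsWeight_pos a
    simp only [systemWeight, List.map_cons, List.map_nil, List.sum_cons, List.sum_nil, rhsWeight]
    nlinarith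
  | split_or a b c =>
    have := rhsWeight_pos c
    simp only [systemWeight, List.map_cons, List.map_nil, List.sum_cons, List.sum_nil, lhsWeight]
    nlinarith
  | resid_box a b | resid_imp a _ b =>
    have := lhsWeight_pos a
    have := rhsWeight_pos b
    simp only [systemWeight, List.map_cons, List.map_nil, List.sum_cons, List.sum_nil, lhsWeight,
      rhsWeight]
    nlinarith
  | approx_box a m n h =>
    simp only [systemWeight, List.map_cons, List.map_nil, List.sum_cons, List.sum_nil, lhsWeight,
      rhsWeight, boxWeight_eq h]
    simp only [boxWeight]
    omega
  | approx_imp a b m j n h =>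
    simp only [systemWeight, List.map_cons, List.map_nil, List.sum_cons, List.sum_nil, lhsWeight,
      rhsWeight, impWeight_eq h]
    simp only [impWeight]
    omega
  | delete a =>
    have := lhsWeight_pos a
    simpa [systemWeight, rhsWeight] using this

lemma ReduceStep.systemWeight_lt {S S' : List (XIneq P)} (h : ReduceStep S S') :
    systemWeight S' < systemWeight S := by
  cases h with
  | mk S T e l h =>
    have := h.systemWeight_lt
    rw [List.append_cons]
    simp only [systemWeight_append]
    omega

lemma SplitStep.systemWeight_lt {L L' : List (Fml P × Fml P)} (h : SplitStep L L') :
    systemWeight (L'.map fun e => ⟨e.1.toX, e.2.toX⟩) <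
      systemWeight (L.map fun e => ⟨e.1.toX, e.2.toX⟩) := by
  cases h with
  | and S T a b c =>
    simpa [Fml.toX] using (ReduceStep.mk (S.map fun e => (⟨e.1.toX, e.2.toX⟩ : XIneq P))
      (T.map fun e => ⟨e.1.toX, e.2.toX⟩) _ _ (.split_and a.toX b.toX c.toX)).systemWeight_lt
  | or S T a b c =>
    simpa [Fml.toX] using (ReduceStep.mk (S.map fun e => (⟨e.1.toX, e.2.toX⟩ : XIneq P))
      (T.map fun e => ⟨e.1.toX, e.2.toX⟩) _ _ (.split_or a.toX b.toX c.toX)).systemWeight_lt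

/-! ### The Ackermann rule -/

/-- The shapes of the inequalities in systems to which only the Ackermann rule applies. -/
inductive IsAckermannShape (Ω : P → P → Prop) : XIneq P → Prop
  | bound {θ p} : θ.IsSynClosed {q | Ω q p} → IsAckermannShape Ω ⟨θ, .var p⟩
  | refute {θ} (m) : θ.IsSynClosed univ → IsAckermannShape Ω ⟨θ, .conom m⟩
  | pure {e} : (∀ p, ¬ e.lhs.Mentions p) → (∀ p, ¬ e.rhs.Mentions p) → IsAckermannShape Ω e

lemma exists_freshNom (S : List (XIneq P)) : ∃ j, FreshNom S j := by
  have hfin : ({0} ∪ ⋃ e ∈ {e | e ∈ S}, (e.lhs.noms ∪ e.rhs.noms)).Finite :=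
    (finite_singleton 0).union (S.finite_toSet.biUnion fun e _ =>
      e.lhs.finite_noms.union e.rhs.finite_noms)
  obtain ⟨j, hj⟩ := hfin.exists_notMem
  simp only [mem_union, mem_iUnion, not_or, not_exists] at hj
  exact ⟨j, hj.1, fun e he => hj.2 e he⟩

lemma exists_freshConom (S : List (XIneq P)) : ∃ n, FreshConom S n := by
  have hfin : ({0} ∪ ⋃ e ∈ {e | e ∈ S}, (e.lhs.conoms ∪ e.rhs.conoms)).Finite :=
    (finite_singleton 0).union (S.finite_toSet.biUnion fun e _ =>
      e.lhs.finite_conoms.union e.rhs.finite_conoms)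
  obtain ⟨n, hn⟩ := hfin.exists_notMem
  simp only [mem_union, mem_iUnion, not_or, not_exists] at hn
  exact ⟨n, hn.1, fun e he => hn.2 e he⟩

lemma not_localRule_of_exhausted {S : List (XIneq P)} (hS : ∀ S', ¬ ReduceStep S S')
    {e : XIneq P} (he : e ∈ S) (l : List (XIneq P)) : ¬ LocalRule S e l := by
  obtain ⟨S₁, S₂, rfl⟩ := List.append_of_mem he
  exact fun h => hS _ (.mk S₁ S₂ e l h)

/-- A tame system to which no rule of the reduction applies is in Ackermann shape. -/
lemma isAckermannShape_of_exhausted {S : List (XIneq P)} (hS : ∀ S', ¬ ReduceStep S S')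
    (ht : ∀ e ∈ S, IsTame Ω e) : ∀ e ∈ S, IsAckermannShape Ω e := by
  intro e he
  have hno := not_localRule_of_exhausted hS he
  have hpia : ∀ {θ : XFml P} {p : P} {a : Fml P}, (∀ l, ¬ LocalRule S ⟨θ, a.toX⟩ l) →
      θ.IsSynClosed {q | Ω q p} → IsPIA Ω p a → IsAckermannShape Ω ⟨θ, a.toX⟩ := by
    intro θ p a hno hθ ha
    cases ha with
    | var => exact .bound hθ
    | top => exact (hno _ (.delete _)).elim
    | box => exact (hno _ (.resid_box _ _)).elim
    | imp => exact (hno _ (.resid_imp _ _ _)).elim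
  cases ht e he with
  | ant i ha =>
    cases ha with
    | pia ha => exact hpia hno (.nom i) ha
    | and => exact (hno _ (.split_and _ _ _)).elim
  | pia hθ ha => exact hpia hno hθ ha
  | suc m ha =>
    cases ha with
    | var => exact .refute m (.var trivial)
    | top => exact .refute m .top
    | imp =>
      obtain ⟨j, hj⟩ := exists_freshNom S
      obtain ⟨n, hn⟩ := exists_freshConom S
      refine (hno _ (.approx_imp _ _ m j n ?_ hj hn)).elim
      rintro ⟨i, k, h, -⟩
      exact toX_ne_nom _ _ h
    | box =>
      obtain ⟨n, hn⟩ := exists_freshConom S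
      exact (hno _ (.approx_box _ m n (toX_ne_conom _) hn)).elim
    | or => exact (hno _ (.split_or _ _ _)).elim
  | box n m =>
    exact .pure (by simp [XFml.Mentions, XFml.Occurs]) (by simp [XFml.Mentions, XFml.Occurs])
  | imp j n m =>
    exact .pure (by simp [XFml.Mentions, XFml.Occurs]) (by simp [XFml.Mentions, XFml.Occurs])

/-- The substituted minimal valuation of `p` is built from variables below `p`. -/
lemma isSynClosed_of_bound {θ : XFml P} {p : P} (h : IsAckermannShape Ω ⟨θ, .var p⟩) :
    θ.IsSynClosed {q | Ω q p} := by
  cases h with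
  | bound h => exact h
  | pure _ h => exact (h p (XFml.mentions_var.2 rfl)).elim

lemma isAckermannShape_subst (htrans : ∀ p q r, Ω p q → Ω q r → Ω p r) {p : P} {θ : XFml P}
    (hθ : θ.IsSynClosed {q | Ω q p}) {e : XIneq P} (he : IsAckermannShape Ω e)
    (hneg : e.rhs.NegativeIn p) : IsAckermannShape Ω (e.subst p θ) := by
  cases he with
  | @bound η q hη =>
    have hqp : q ≠ p := fun hqp => hneg ⟨rfl, hqp⟩
    have hvar : XFml.subst p θ (.var q) = .var q :=
      XFml.subst_of_not_mentions (by simpa [XFml.mentions_var] using hqp)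
    rw [XIneq.subst, hvar]
    exact .bound (hη.subst fun hp => hθ.mono fun r hr => htrans _ _ _ hr hp)
  | refute m hη => exact .refute m (hη.subst fun _ => hθ.mono (subset_univ _))
  | pure h1 h2 =>
    rw [XIneq.subst, XFml.subst_of_not_mentions (h1 p), XFml.subst_of_not_mentions (h2 p)]
    exact .pure h1 h2

lemma AckermannStep.isAckermannShape (htrans : ∀ p q r, Ω p q → Ω q r → Ω p r)
    {S S' : List (XIneq P)} (h : AckermannStep Ω S S') (hS : ∀ e ∈ S, IsAckermannShape Ω e) :
    ∀ e ∈ S', IsAckermannShape Ω e := by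
  cases h with
  | mk p θs E _ _ hperm _ hE =>
    have hθ : (XFml.bigOr θs).IsSynClosed {q | Ω q p} := .bigOr fun θ hθ =>
      isSynClosed_of_bound (hS _ (hperm.mem_iff.2
        (List.mem_append_left _ (List.mem_map_of_mem hθ))))
    intro e' he'
    obtain ⟨e, he, rfl⟩ := List.mem_map.1 he'
    exact isAckermannShape_subst htrans hθ
      (hS e (hperm.mem_iff.2 (List.mem_append_right _ he))) (hE e he).2

section Soundness

variable {X : Type*} {R : X → X → Prop} {V : P → Set X}

lemma holds_subst [DecidableEq P] {g : IndVar → X} {p : P} {θ : XFml P} {e : XIneq P} :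
    (e.subst p θ).Holds R V g ↔ e.Holds R (Function.update V p (θ.truth R V g)) g := by
  rw [XIneq.Holds, XIneq.Holds, XIneq.subst, XFml.truth_subst, XFml.truth_subst]

/-- Inequalities in Ackermann shape other than the bounds of `p` are antitone in the value
of `p`. -/
lemma IsAckermannShape.holds_antitone [DecidableEq P] {e : XIneq P} (he : IsAckermannShape Ω e)
    {p : P} (hneg : e.rhs.NegativeIn p) {g : IndVar → X} {C U : Set X} (hCU : C ⊆ U)
    (h : e.Holds R (Function.update V p U) g) : e.Holds R (Function.update V p C) g := by
  have hle : ∀ q, Function.update V p C q ⊆ Function.update V p U q := fun q => by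
    by_cases hq : q = p
    · subst hq; simpa using hCU
    · simp [hq]
  cases he with
  | @bound η q hη =>
    have hqp : q ≠ p := fun hqp => hneg ⟨rfl, hqp⟩
    have := (hη.truth_mono hle g).trans h
    simpa [XIneq.Holds, XFml.truth, hqp] using this
  | refute m hη => exact (hη.truth_mono hle g).trans h
  | pure h1 h2 =>
    rw [XIneq.Holds] at h ⊢
    rwa [XFml.truth_congr (V' := Function.update V p U) (g' := g) (fun q hq => (h1 q hq).elim)
        (fun _ _ => rfl) (fun _ _ => rfl),
      XFml.truth_congr (V' := Function.update V p U) (g' := g) (fun q hq => (h2 q hq).elim)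
        (fun _ _ => rfl) (fun _ _ => rfl)]

variable [TopologicalSpace X] {K : Set (Set X)}

lemma IsAckermannShape.exists_admissible_holds [DecidableEq P] (hX : IsGenModalSpace K R)
    (hV : ∀ p, V p ∈ admissibleSets K) {e : XIneq P} (he : IsAckermannShape Ω e) {p : P}
    (hneg : e.rhs.NegativeIn p) {g : IndVar → X} {C : Set X} (hC : IsClosed C)
    (h : e.Holds R (Function.update V p C) g) :
    ∃ U ∈ admissibleSets K, C ⊆ U ∧ e.Holds R (Function.update V p U) g := by
  have : Nonempty X := ⟨g (Sum.inl 0)⟩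
  have hVc : ∀ q, IsClosed (V q) := fun q => hX.isClosed_of_mem_admissibleSets (hV q)
  cases he with
  | @bound η q hη =>
    have hqp : q ≠ p := fun hqp => hneg ⟨rfl, hqp⟩
    simp only [XIneq.Holds, XFml.truth, Function.update_of_ne hqp] at h ⊢
    exact hη.exists_admissible_truth_subset hX hVc g p hC (hX.isCompact _ (hV q)) h
  | refute m hη =>
    exact hη.exists_admissible_truth_subset hX hVc g p hC (W := {g (Sum.inr m)}ᶜ)
      (by rw [compl_compl]; exact isCompact_singleton) h
  | pure h1 h2 =>
    refine ⟨univ, hX.univ_mem_admissibleSets, subset_univ _, ?_⟩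
    rw [XIneq.Holds] at h ⊢
    rwa [XFml.truth_congr (V' := Function.update V p C) (g' := g) (fun q hq => (h1 q hq).elim)
        (fun _ _ => rfl) (fun _ _ => rfl),
      XFml.truth_congr (V' := Function.update V p C) (g' := g) (fun q hq => (h2 q hq).elim)
        (fun _ _ => rfl) (fun _ _ => rfl)]

/-- One admissible value of `p` serves finitely many inequalities, since admissible sets are
closed under intersection. -/
lemma exists_admissible_forall_holds [DecidableEq P] (hX : IsGenModalSpace K R)
    (hV : ∀ p, V p ∈ admissibleSets K) {p : P} {g : IndVar → X} {C : Set X} (hC : IsClosed C)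
    {E : List (XIneq P)} (hshape : ∀ e ∈ E, IsAckermannShape Ω e)
    (hneg : ∀ e ∈ E, e.rhs.NegativeIn p) (h : ∀ e ∈ E, e.Holds R (Function.update V p C) g) :
    ∃ U ∈ admissibleSets K, C ⊆ U ∧ ∀ e ∈ E, e.Holds R (Function.update V p U) g := by
  have : Nonempty X := ⟨g (Sum.inl 0)⟩
  induction E with
  | nil => exact ⟨univ, hX.univ_mem_admissibleSets, subset_univ _, by simp⟩
  | cons e E ih =>
    rw [List.forall_mem_cons] at hshape hneg h
    obtain ⟨U, hU, hCU, hUE⟩ := ih hshape.2 hneg.2 h.2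
    obtain ⟨W, hW, hCW, hWe⟩ := hshape.1.exists_admissible_holds hX hV hneg.1 hC h.1
    refine ⟨U ∩ W, hX.inter_mem_admissibleSets hU hW, subset_inter hCU hCW, ?_⟩
    rw [List.forall_mem_cons]
    exact ⟨hshape.1.holds_antitone hneg.1 inter_subset_right hWe, fun e' he' =>
      (hshape.2 e' he').holds_antitone (hneg.2 e' he') inter_subset_left (hUE e' he')⟩

/-- Soundness of the Ackermann rule on generalized modal spaces. The minimal valuation
`θ₁ ∨ … ∨ θₙ` is a closed set but need not be admissible, not even for `n = 0`; it is enlarged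
to an admissible one. -/
lemma AckermannStep.quasiValid_iff (hX : IsGenModalSpace K R) {S S' : List (XIneq P)}
    (h : AckermannStep Ω S S') (hS : ∀ e ∈ S, IsAckermannShape Ω e) :
    QuasiValid K R S ↔ QuasiValid K R S' := by
  classical
  cases h with
  | mk p θs E _ _ hperm hθs hE =>
    have hθmem : ∀ θ ∈ θs, (⟨θ, .var p⟩ : XIneq P) ∈ S := fun θ hθ =>
      hperm.mem_iff.2 (List.mem_append_left _ (List.mem_map_of_mem hθ))
    have hEmem : ∀ e ∈ E, e ∈ S := fun e he => hperm.mem_iff.2 (List.mem_append_right _ he)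
    refine ⟨fun H V hV g hg => ?_, fun H V hV g hg => H V hV g ?_⟩
    · have hC : IsClosed ((XFml.bigOr θs).truth R V g) :=
        (XFml.IsSynClosed.bigOr fun θ hθ =>
          isSynClosed_of_bound (hS _ (hθmem θ hθ))).isClosed_truth hX
          (fun q => hX.isClosed_of_mem_admissibleSets (hV q)) g
      obtain ⟨U, hU, hCU, hUE⟩ := exists_admissible_forall_holds (E := E) hX hV (p := p) hC
        (fun e he => hS e (hEmem e he)) (fun e he => (hE e he).2)
        fun e he => holds_subst.1 (hg _ (List.mem_map_of_mem he))
      refine H (Function.update V p U) (fun q => ?_) g fun e he => ?_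
      · by_cases hq : q = p
        · subst hq; simpa using hU
        · simpa [hq] using hV q
      · rcases List.mem_append.1 (hperm.mem_iff.1 he) with he | he
        · obtain ⟨θ, hθ, rfl⟩ := List.mem_map.1 he
          rw [XIneq.Holds, XFml.truth_congr (a := θ) (V' := V) (g' := g) (fun q hq =>
            Function.update_of_ne (by rintro rfl; exact hθs θ hθ hq) _ _) (fun _ _ => rfl)
            (fun _ _ => rfl), XFml.truth, Function.update_self]
          refine Subset.trans (fun x hx => ?_) hCU
          rw [XFml.truth_bigOr]
          exact ⟨θ, hθ, hx⟩
        · exact hUE e he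
    · intro e' he'
      obtain ⟨e, he, rfl⟩ := List.mem_map.1 he'
      have hsub : (XFml.bigOr θs).truth R V g ⊆ V p := by
        rw [XFml.truth_bigOr]
        rintro x ⟨θ, hθ, hx⟩
        exact hg _ (hθmem θ hθ) hx
      refine holds_subst.2 ((hS e (hEmem e he)).holds_antitone (hE e he).2 hsub ?_)
      rw [Function.update_eq_self]
      exact hg e (hEmem e he)

end Soundness

/-! ### Elimination of all variables -/

lemma finite_varOf (S : List (XIneq P)) : {p | VarOf S p}.Finite := by
  refine (S.finite_toSet.biUnion fun e _ =>
    e.lhs.finite_setOf_mentions.union e.rhs.finite_setOf_mentions).subset ?_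
  rintro p ⟨e, he, hp⟩
  exact mem_biUnion he hp

lemma exists_minimal_varOf (hirr : ∀ p, ¬ Ω p p) (htrans : ∀ p q r, Ω p q → Ω q r → Ω p r)
    {S : List (XIneq P)} (hS : ∃ p, VarOf S p) : ∃ p, VarOf S p ∧ ∀ q, VarOf S q → ¬ Ω q p := by
  have := (finite_varOf S).to_subtype
  have : IsTrans {p | VarOf S p} fun a b => Ω a b := ⟨fun _ _ _ => htrans _ _ _⟩
  have : Std.Irrefl (α := {p | VarOf S p}) fun a b => Ω a b := ⟨fun _ => hirr _⟩
  obtain ⟨p, hp⟩ := hS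
  obtain ⟨m, -, hm⟩ := (Finite.wellFounded_of_trans_of_irrefl
    (fun a b : {p | VarOf S p} => Ω a b)).has_min univ ⟨⟨p, hp⟩, trivial⟩
  exact ⟨m, m.2, fun q hq => hm ⟨q, hq⟩ trivial⟩

/-- Separation of the bounds `θ ≤ p` from the rest of a system. -/
lemma exists_perm_bounds (p : P) (S : List (XIneq P)) : ∃ (θs : List (XFml P))
    (E : List (XIneq P)), S.Perm (θs.map (fun θ => ⟨θ, .var p⟩) ++ E) ∧
      ∀ e ∈ E, e.rhs ≠ .var p := by
  induction S with
  | nil => exact ⟨[], [], .nil, by simp⟩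
  | cons e S ih =>
    obtain ⟨θs, E, hperm, hE⟩ := ih
    by_cases he : e.rhs = .var p
    · obtain ⟨η, ι⟩ := e
      subst he
      exact ⟨η :: θs, E, hperm.cons _, hE⟩
    · refine ⟨θs, e :: E, (hperm.cons e).trans List.perm_middle.symm, ?_⟩
      rw [List.forall_mem_cons]
      exact ⟨he, hE⟩

lemma exists_ackermannStep (hirr : ∀ p, ¬ Ω p p) (htrans : ∀ p q r, Ω p q → Ω q r → Ω p r)
    {S : List (XIneq P)} (hshape : ∀ e ∈ S, IsAckermannShape Ω e) (hS : ∃ p, VarOf S p) :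
    ∃ S', AckermannStep Ω S S' := by
  obtain ⟨p, hp, hmin⟩ := exists_minimal_varOf hirr htrans hS
  obtain ⟨θs, E, hperm, hE⟩ := exists_perm_bounds p S
  refine ⟨_, .mk S p θs E hp hmin hperm (fun θ hθ hθp => ?_) fun e he => ?_⟩
  · have := isSynClosed_of_bound (hshape _ (hperm.mem_iff.2
      (List.mem_append_left _ (List.mem_map_of_mem hθ))))
    exact hirr p (this.mem_of_mentions hθp)
  · have hne := hE e he
    cases hshape e (hperm.mem_iff.2 (List.mem_append_right _ he)) with
    | @bound η q hη =>
      refine ⟨hη.positiveIn p, fun hq => hne ?_⟩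
      rw [hq.2]
    | refute m hη => exact ⟨hη.positiveIn p, fun h => h⟩
    | pure h1 h2 => exact ⟨fun h => h1 p (.inr h), fun h => h2 p (.inl h)⟩

lemma mentions_bigOr {l : List (XFml P)} {q : P} (h : (XFml.bigOr l).Mentions q) :
    ∃ a ∈ l, a.Mentions q := by
  induction l using XFml.bigOr.induct with
  | case1 => simp [XFml.bigOr, XFml.Mentions, XFml.Occurs] at h
  | case2 a => exact ⟨a, by simp, h⟩
  | case3 a b l ih =>
    rw [XFml.bigOr, XFml.mentions_or] at h
    rcases h with h | h
    · exact ⟨a, by simp, h⟩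
    · obtain ⟨c, hc, hcq⟩ := ih h
      exact ⟨c, List.mem_cons_of_mem _ hc, hcq⟩

lemma AckermannStep.ncard_varOf_lt {S S' : List (XIneq P)} (h : AckermannStep Ω S S') :
    {q | VarOf S' q}.ncard < {q | VarOf S q}.ncard := by
  cases h with
  | mk p θs E hp _ hperm hθs _ =>
    have key : ∀ {q : P} {a : XFml P}, (XFml.subst p (XFml.bigOr θs) a).Mentions q →
        (∃ e ∈ S, e.lhs.Mentions q ∧ q ≠ p) ∨ (a.Mentions q ∧ q ≠ p) := by
      intro q a hq
      refine (XFml.mentions_of_mentions_subst hq).imp_left fun hq => ?_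
      obtain ⟨θ, hθ, hθq⟩ := mentions_bigOr hq
      refine ⟨_, hperm.mem_iff.2 (List.mem_append_left _ (List.mem_map_of_mem hθ)), hθq, ?_⟩
      rintro rfl
      exact hθs θ hθ hθq
    have hsub : ∀ q, VarOf (E.map (XIneq.subst p (XFml.bigOr θs))) q → VarOf S q ∧ q ≠ p := by
      rintro q ⟨e', he', hq⟩
      obtain ⟨e, he, rfl⟩ := List.mem_map.1 he'
      have heS : e ∈ S := hperm.mem_iff.2 (List.mem_append_right _ he)
      rcases hq with hq | hq <;> rcases key hq with ⟨d, hd, hdq, hqp⟩ | ⟨hdq, hqp⟩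
      exacts [⟨⟨d, hd, .inl hdq⟩, hqp⟩, ⟨⟨e, heS, .inl hdq⟩, hqp⟩, ⟨⟨d, hd, .inl hdq⟩, hqp⟩,
        ⟨⟨e, heS, .inr hdq⟩, hqp⟩]
    refine ncard_lt_ncard ⟨fun q hq => (hsub q hq).1, fun hle => ?_⟩ (finite_varOf S)
    exact (hsub p (hle hp)).2 rfl

lemma exists_map_ofPure_eq {S : List (XIneq P)} (h : ¬ ∃ p, VarOf S p) :
    ∃ T : List (XIneq Empty), T.map XIneq.ofPure = S := by
  induction S with
  | nil => exact ⟨[], rfl⟩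
  | cons e S ih =>
    obtain ⟨T, hT⟩ := ih fun ⟨p, d, hd, hp⟩ => h ⟨p, d, List.mem_cons_of_mem _ hd, hp⟩
    obtain ⟨a, ha⟩ := XFml.exists_ofPure_eq (a := e.lhs) fun p hp => h ⟨p, e, by simp, .inl hp⟩
    obtain ⟨b, hb⟩ := XFml.exists_ofPure_eq (a := e.rhs) fun p hp => h ⟨p, e, by simp, .inr hp⟩
    exact ⟨⟨a, b⟩ :: T, by simp [XIneq.ofPure, ha, hb, hT]⟩

lemma exists_pure_of_isAckermannShape (hirr : ∀ p, ¬ Ω p p)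
    (htrans : ∀ p q r, Ω p q → Ω q r → Ω p r) {S : List (XIneq P)}
    (hshape : ∀ e ∈ S, IsAckermannShape Ω e) :
    ∃ T : List (XIneq Empty), Relation.ReflTransGen (AckermannStep Ω) S (T.map XIneq.ofPure) := by
  induction h : {q | VarOf S q}.ncard using Nat.strong_induction_on generalizing S with
  | _ n ih =>
    by_cases hS : ∃ p, VarOf S p
    · obtain ⟨S', hS'⟩ := exists_ackermannStep hirr htrans hshape hS
      obtain ⟨T, hT⟩ := ih _ (h ▸ hS'.ncard_varOf_lt) (hS'.isAckermannShape htrans hshape) rfl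
      exact ⟨T, .head hS' hT⟩
    · obtain ⟨T, rfl⟩ := exists_map_ofPure_eq hS
      exact ⟨T, .refl⟩

/-! ### Correctness and existence of runs -/

lemma isTame_firstApprox {L : List (Fml P × Fml P)} (hL : ∀ e ∈ L, IsDistributed Ω e)
    (hex : ∀ L', ¬ SplitStep L L') {e : Fml P × Fml P} (he : e ∈ L) :
    ∀ e' ∈ firstApprox e, IsTame Ω e' := by
  obtain ⟨⟨ha, hna⟩, hs, hns⟩ := hL e he
  obtain ⟨L₁, L₂, rfl⟩ := List.append_of_mem he
  have h1 : IsConjPIA Ω e.1 := isConjPIA_of_isAnt ha hna fun b c h => by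
    obtain ⟨a, d⟩ := e
    subst h
    exact hex _ (.or L₁ L₂ b c d)
  have h2 : IsFlatSuc Ω e.2 := isFlatSuc_of_isSuc hs hns fun b c h => by
    obtain ⟨a, d⟩ := e
    subst h
    exact hex _ (.and L₁ L₂ a b c)
  simp [firstApprox, IsTame.ant 0 h1, IsTame.suc 0 h2]

lemma isDistributed_of_exhausts {φ ψ φ' ψ' : Fml P} (h : IsInductive Ω φ ψ)
    (hφ : Exhausts (Rewrite AntRule) φ φ') (hψ : Exhausts (Rewrite SucRule) ψ ψ')
    {L : List (Fml P × Fml P)} (hL : Relation.ReflTransGen SplitStep [(φ', ψ')] L) :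
    ∀ e ∈ L, IsDistributed Ω e := by
  induction hL with
  | refl =>
    rw [List.forall_mem_singleton]
    refine ⟨⟨?_, hφ.2⟩, ?_, hψ.2⟩
    · exact Relation.ReflTransGen.head_induction_on (motive := fun a _ => IsAnt Ω a → IsAnt Ω φ')
        hφ.1 id (fun hs _ ih ha => ih (hs.isAnt ha)) h.ant
    · exact Relation.ReflTransGen.head_induction_on (motive := fun a _ => IsSuc Ω a → IsSuc Ω ψ')
        hψ.1 id (fun hs _ ih ha => ih (hs.isSuc ha)) h.suc
  | tail _ hs ih => exact hs.isDistributed ih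

lemma Reduces.quasiValid_iff {X : Type*} [TopologicalSpace X] {K : Set (Set X)}
    {R : X → X → Prop} (hX : IsGenModalSpace K R) (htrans : ∀ p q r, Ω p q → Ω q r → Ω p r)
    {S : List (XIneq P)} {T : List (XIneq Empty)} (h : Reduces Ω S T)
    (hS : ∀ e ∈ S, IsTame Ω e) :
    QuasiValid K R S ↔ QuasiValid K R (T.map (XIneq.ofPure (P := P))) := by
  obtain ⟨S', ⟨hred, hex⟩, hack⟩ := h
  have h1 : (∀ e ∈ S', IsTame Ω e) ∧ (QuasiValid K R S ↔ QuasiValid K R S') := by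
    clear hex hack
    induction hred with
    | refl => exact ⟨hS, .rfl⟩
    | tail _ hs ih => exact ⟨hs.isTame ih.1, ih.2.trans hs.quasiValid_iff⟩
  have h2 := isAckermannShape_of_exhausted hex h1.1
  have h3 : ∀ {S''}, Relation.ReflTransGen (AckermannStep Ω) S' S'' →
      (∀ e ∈ S'', IsAckermannShape Ω e) ∧ (QuasiValid K R S' ↔ QuasiValid K R S'') := by
    intro S'' hack
    induction hack with
    | refl => exact ⟨h2, .rfl⟩
    | tail _ hs ih => exact ⟨hs.isAckermannShape htrans ih.1, ih.2.trans (hs.quasiValid_iff hX ih.1)⟩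
  exact h1.2.trans (h3 hack).2

lemma exists_reduces (hirr : ∀ p, ¬ Ω p p) (htrans : ∀ p q r, Ω p q → Ω q r → Ω p r)
    {S : List (XIneq P)} (hS : ∀ e ∈ S, IsTame Ω e) :
    ∃ T : List (XIneq Empty), Reduces Ω S T := by
  obtain ⟨S', hred, hex⟩ :=
    exists_exhausts (step := ReduceStep) systemWeight (fun _ _ h => h.systemWeight_lt) S
  have h1 : ∀ e ∈ S', IsTame Ω e := by
    clear hex
    induction hred with
    | refl => exact hS
    | tail _ hs ih => exact hs.isTame ih
  obtain ⟨T, hT⟩ := exists_pure_of_isAckermannShape hirr htrans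
    (isAckermannShape_of_exhausted hex h1)
  exact ⟨T, S', ⟨hred, hex⟩, hT⟩

/-- A pure quasi-inequality is valid under the admissible valuations if and only if it is true
of all points: there is an admissible valuation as soon as there is a point. -/
lemma quasiValid_map_ofPure {X : Type*} [TopologicalSpace X] {K : Set (Set X)}
    {R : X → X → Prop} (hX : IsGenModalSpace K R) (T : List (XIneq Empty)) :
    QuasiValid K R (T.map (XIneq.ofPure (P := P))) ↔ ∀ g : IndVar → X,
      (∀ e ∈ T, e.Holds R (fun e => e.elim) g) → g (Sum.inl 0) ≠ g (Sum.inr 0) := by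
  have key : ∀ (V : P → Set X) (g : IndVar → X),
      (∀ e ∈ T.map (XIneq.ofPure (P := P)), e.Holds R V g) ↔
        ∀ e ∈ T, e.Holds R (fun e => e.elim) g := fun V g => by
    rw [List.forall_mem_map]
    refine forall₂_congr fun e _ => ?_
    rw [XIneq.Holds, XIneq.ofPure, XFml.truth_ofPure V (fun e => e.elim),
      XFml.truth_ofPure V (fun e => e.elim), XIneq.Holds]
  refine ⟨fun H g hg => ?_, fun H V _ g hg => H g ((key V g).1 hg)⟩
  have : Nonempty X := ⟨g (Sum.inl 0)⟩
  exact H (fun _ => univ) (fun _ => hX.univ_mem_admissibleSets) g ((key _ g).2 hg)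

lemma quasiValid_firstApprox {X : Type*} {K : Set (Set X)} {R : X → X → Prop}
    (e : Fml P × Fml P) :
    QuasiValid K R (firstApprox e) ↔ AdmissiblyValid K R e.1 e.2 := by
  refine forall₂_congr fun V _ => ?_
  have key : ∀ g : IndVar → X, (∀ e' ∈ firstApprox e, e'.Holds R V g) ↔
      g (Sum.inl 0) ∈ e.1.truth R V ∧ g (Sum.inr 0) ∉ e.2.truth R V := fun g => by
    simp [firstApprox, XIneq.Holds, XFml.truth, Fml.truth_toX]
  constructor
  · intro H x hx
    by_contra hx'
    exact H (fun _ => x) ((key _).2 ⟨hx, hx'⟩) rfl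
  · intro H g hg heq
    obtain ⟨h1, h2⟩ := (key g).1 hg
    exact h2 (heq ▸ H h1)

/-- Every run outputs a first-order correspondent. -/
theorem Outputs.admissiblyValid_iff {φ ψ : Fml P} (h : IsInductive Ω φ ψ)
    {χ : (corrLang Empty).Sentence} (hχ : Outputs Ω φ ψ χ) {X : Type*} [TopologicalSpace X]
    {K : Set (Set X)} {R : X → X → Prop} (hX : IsGenModalSpace K R) :
    AdmissiblyValid K R φ ψ ↔ FOTrue R χ := by
  obtain ⟨φ', ψ', L, Q, hφ, hψ, ⟨hL, hLex⟩, hQ, rfl⟩ := hχ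
  have hdist := isDistributed_of_exhausts h hφ hψ hL
  have hvalid : AdmissiblyValid K R φ ψ ↔ ∀ e ∈ L, AdmissiblyValid K R e.1 e.2 := by
    have hsplit : ∀ V : P → Set X, φ.truth R V ⊆ ψ.truth R V ↔
        ∀ e ∈ L, e.1.truth R V ⊆ e.2.truth R V := fun V => by
      rw [truth_eq_of_reflTransGen (AntRule.truth_eq R V) hφ.1,
        truth_eq_of_reflTransGen (SucRule.truth_eq R V) hψ.1]
      clear hdist hQ hLex
      induction hL with
      | refl => simp
      | tail _ hs ih => exact ih.trans hs.truth_subset_iff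
    simp only [AdmissiblyValid, hsplit]
    tauto
  rw [hvalid, foTrue_outputSentence]
  have htame := fun {e} he => isTame_firstApprox (e := e) hdist hLex he
  clear hdist hLex hL hvalid
  induction hQ with
  | nil => simp
  | @cons e T L Q hred _ ih =>
    rw [List.forall_mem_cons, List.forall_mem_cons, ← quasiValid_firstApprox,
      hred.quasiValid_iff hX h.trans (htame (by simp)), quasiValid_map_ofPure hX]
    exact and_congr_right' (ih fun he => htame (List.mem_cons_of_mem _ he))

/-- The rules of each stage terminate, and the Ackermann rule applies to the result as long as
variables remain. -/
theorem exists_outputs {φ ψ : Fml P} (h : IsInductive Ω φ ψ) :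
    ∃ χ : (corrLang Empty).Sentence, Outputs Ω φ ψ χ := by
  obtain ⟨φ', hφ⟩ := exists_exhausts antMeasure (fun _ _ h => antMeasure_lt h) φ
  obtain ⟨ψ', hψ⟩ := exists_exhausts sucMeasure (fun _ _ h => sucMeasure_lt h) ψ
  obtain ⟨L, hL⟩ := exists_exhausts (step := SplitStep)
    (fun L => systemWeight (L.map fun e => ⟨e.1.toX, e.2.toX⟩))
    (fun _ _ h => h.systemWeight_lt) [(φ', ψ')]
  have htame := fun {e} he =>
    isTame_firstApprox (e := e) (isDistributed_of_exhausts h hφ hψ hL.1) hL.2 he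
  obtain ⟨Q, hQ⟩ : ∃ Q, List.Forall₂ (fun e T => Reduces Ω (firstApprox e) T) L Q := by
    clear hL
    induction L with
    | nil => exact ⟨[], .nil⟩
    | cons e L ih =>
      obtain ⟨T, hT⟩ := exists_reduces h.irrefl h.trans (htame (e := e) (by simp))
      obtain ⟨Q, hQ⟩ := ih fun he => htame (List.mem_cons_of_mem _ he)
      exact ⟨T :: Q, .cons hT hQ⟩
  exact ⟨_, φ', ψ', L, Q, hφ, hψ, hL, hQ, rfl⟩

end ALBA

end GenModal

theorem mainTheorem1 {P : Type u} (Ω : P → P → Prop) (φ ψ : GenModal.Fml P)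
    (h : GenModal.IsInductive Ω φ ψ) :
    (∀ χ : (GenModal.corrLang Empty).Sentence, GenModal.ALBA.Outputs Ω φ ψ χ →
      ∀ (X : Type w) [TopologicalSpace X] (K : Set (Set X)) (R : X → X → Prop),
        GenModal.IsGenModalSpace K R →
          (GenModal.AdmissiblyValid K R φ ψ ↔ GenModal.FOTrue R χ)) ∧
    (∃ χ : (GenModal.corrLang Empty).Sentence, GenModal.ALBA.Outputs Ω φ ψ χ ∧
      ∀ (X : Type w) [TopologicalSpace X] (K : Set (Set X)) (R : X → X → Prop),
        GenModal.IsGenModalSpace K R →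
          (GenModal.AdmissiblyValid K R φ ψ ↔ GenModal.FOTrue R χ)) := by
  refine ⟨fun χ hχ X _ K R hX => hχ.admissiblyValid_iff h hX, ?_⟩
  obtain ⟨χ, hχ⟩ := GenModal.ALBA.exists_outputs h
  exact ⟨χ, hχ, fun X _ K R hX => hχ.admissiblyValid_iff h hX⟩
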